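/- **Conventions.** For a polyhedron $P\subseteq\mathbb{R}^d$, $f_k(P)$ denotes the number of its nonempty $k$-dimensional faces ($P$ itself included). Let $d\ge 2$ and $n>d$ be integers such that $\lfloor d/2\rfloor$ divides $n$ if $d$ is even, and divides $n-1$ if $d$ is odd. Put $q=n/\lfloor d/2\rfloor$ for $d$ even and $q=(n-1)/\lfloor d/2\rfloor$ for $d$ odd. * $P^*(n,d)$ is any polyhedron of the form $$\{x\in\mathbb{R}^d : (x_{2i-1},x_{2i})\in P_i \text{ for } 1\le i\le \lfloor d/2\rfloor,\ \text{ and } x_d\ge 0 \text{ if } d \text{ is odd}\},$$ where each $P_i\subset\mathbb{R}^2$ is a bounded polygon given by $q$ linear inequalities and having exactly $q$ vertices. It is given by $n$ linear inequalities, each involving at most two variables (i.e. it is in $LI(2)$). * $c^*(n,d)$ is any dual cyclic polytope: the polar dual $\{y\in\mathbb{R}^d : \langle x-c,y\rangle\le 1\ \forall x\in Q\}$ of a cyclic polytope $Q=\operatorname{conv}\{(t_i,t_i^2,\dots,t_i^d):1\le i\le n\}$, $t_1<\dots<t_n$ real, with respect to a point $c$ in the interior of $Q$. **Theorem.** There is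 a polynomial $p$ with real coefficients such that for all $n,d$ as above, all $0\le k\le d$, and all choices of $P^*(n,d)$ and $c^*(n,d)$: $$f_k(c^*(n,d))\le p(d)\, e^{\lfloor d/2\rfloor}\, f_k(P^*(n,d))\quad\text{if } k<\lceil d/2\rceil,$$ $$f_k(c^*(n,d))\le p(d)\, e^{d-k}\, f_k(P^*(n,d))\quad\text{if } k\ge\lceil d/2\rceil.$$ Moreover, for every fixed $d\ge 2$ the face numbers are of the same order: there are constants $a,b>0$ depending only on $d$ such that for all such $n$, all $0\le k\le d$, and all choices of $P^*(n,d)$ and $c^*(n,d)$, $$a\, f_k(P^*(n,d))\le f_k(c^*(n,d))\le b\, f_k(P^*(n,d)).$$ -/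

import Mathlib

/-- The polyhedron `{x | A x ≤ b}` given by `n` linear inequalities in `d` variables. -/
def polyhedron {n d : ℕ} (A : Matrix (Fin n) (Fin d) ℝ) (b : Fin n → ℝ) : Set (Fin d → ℝ) :=
  {x | ∀ j, (A.mulVec x) j ≤ b j}

/-- The `k`-faces of `P`: the nonempty subsets of `P` on which some linear functional attains its
maximum over `P` (the zero functional gives `P` itself), whose affine span has dimension `k`. -/
def kFaces {d : ℕ} (P : Set (Fin d → ℝ)) (k : ℕ) : Set (Set (Fin d → ℝ)) :=
  {F | F.Nonempty ∧ IsExposed ℝ P F ∧ Module.finrank ℝ (vectorSpan ℝ F) = k}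

/-- The face number `f_k(P)`. -/
noncomputable def faceNumber {d : ℕ} (P : Set (Fin d → ℝ)) (k : ℕ) : ℕ :=
  (kFaces P k).ncard

/-- `A x ≤ b` is a system of `q` constraints in the plane that defines a (bounded) polygon
with `q` vertices. -/
def IsPolygonSystem {q : ℕ} (A : Matrix (Fin q) (Fin 2) ℝ) (b : Fin q → ℝ) : Prop :=
  Bornology.IsBounded (polyhedron A b) ∧ faceNumber (polyhedron A b) 0 = q

/-- The points of `ℝ^d` whose consecutive coordinate pairs lie in the given `⌊d/2⌋` planar
polyhedra and, if `d` is odd, whose last coordinate is nonnegative. Every constraint involves at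
most two variables, and there are `⌊d/2⌋ * q` of them (plus one if `d` is odd). -/
def polygonProduct {d q : ℕ} (A : Fin (d / 2) → Matrix (Fin q) (Fin 2) ℝ)
    (b : Fin (d / 2) → Fin q → ℝ) : Set (Fin d → ℝ) :=
  {x | (∀ i : Fin (d / 2),
          ![x ⟨2 * i.val, by omega⟩, x ⟨2 * i.val + 1, by omega⟩] ∈ polyhedron (A i) (b i)) ∧
       ∀ h : d % 2 = 1, 0 ≤ x ⟨d - 1, by omega⟩}

/-- `P` is a polytope `P*(n,d)`: the product of `⌊d/2⌋` polygons, each given by `q` constraints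
and with `q` vertices (times a half-line if `d` is odd), where `n = ⌊d/2⌋ q` for even `d` and
`n = ⌊d/2⌋ q + 1` for odd `d`. -/
def IsPStar (n d : ℕ) (P : Set (Fin d → ℝ)) : Prop :=
  ∃ (q : ℕ) (A : Fin (d / 2) → Matrix (Fin q) (Fin 2) ℝ) (b : Fin (d / 2) → Fin q → ℝ),
    n = d / 2 * q + d % 2 ∧ (∀ i, IsPolygonSystem (A i) (b i)) ∧ P = polygonProduct A b

/-- The moment curve `s ↦ (s, s^2, …, s^d)`. -/
def momentCurve (d : ℕ) (s : ℝ) : Fin d → ℝ := fun i => s ^ (i.val + 1)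

/-- The cyclic polytope with vertices at the parameters `t` on the moment curve. -/
def cyclicPolytope {n : ℕ} (d : ℕ) (t : Fin n → ℝ) : Set (Fin d → ℝ) :=
  convexHull ℝ (Set.range fun i => momentCurve d (t i))

/-- The polar dual of `Q` with respect to the point `c`. -/
def polarDual {d : ℕ} (Q : Set (Fin d → ℝ)) (c : Fin d → ℝ) : Set (Fin d → ℝ) :=
  {y | ∀ x ∈ Q, (x - c) ⬝ᵥ y ≤ 1}

/-- `C` is a dual cyclic polytope `c*(n,d)`: the polar dual, with respect to an interior point, of
a `d`-dimensional cyclic polytope with `n` vertices. -/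
def IsDualCyclic (n d : ℕ) (C : Set (Fin d → ℝ)) : Prop :=
  ∃ (t : Fin n → ℝ) (c : Fin d → ℝ), StrictMono t ∧ c ∈ interior (cyclicPolytope d t) ∧
    C = polarDual (cyclicPolytope d t) c

open Polynomial

/-! ### Tight sets of a system of linear inequalities -/

/-- `J` is the set of constraints of the system `a i x ≤ β i` that are tight at some feasible
point. -/
def IsTightSet {ι V : Type*} [AddCommGroup V] [Module ℝ V] (a : ι → V →ₗ[ℝ] ℝ) (β : ι → ℝ)
    (J : Set ι) : Prop :=
  ∃ x, (∀ i, a i x ≤ β i) ∧ ∀ i, i ∈ J ↔ a i x = β i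

/-- The directions along which all constraints in `J` are constant. -/
def tightKernel {ι V : Type*} [AddCommGroup V] [Module ℝ V] (a : ι → V →ₗ[ℝ] ℝ)
    (J : Set ι) : Submodule ℝ V :=
  ⨅ i ∈ J, LinearMap.ker (a i)

/-- The tight sets whose face has dimension `k`. -/
def tightSets {ι V : Type*} [AddCommGroup V] [Module ℝ V] (a : ι → V →ₗ[ℝ] ℝ) (β : ι → ℝ)
    (k : ℕ) : Set (Set ι) :=
  {J | IsTightSet a β J ∧ Module.finrank ℝ (tightKernel a J) = k}

section TightSets

variable {ι V : Type*} [AddCommGroup V] [Module ℝ V] {a : ι → V →ₗ[ℝ] ℝ} {β : ι → ℝ}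

lemma mem_tightKernel {J : Set ι} {v : V} : v ∈ tightKernel a J ↔ ∀ i ∈ J, a i v = 0 := by
  simp [tightKernel]

lemma tightKernel_anti {J K : Set ι} (h : J ⊆ K) : tightKernel a K ≤ tightKernel a J :=
  fun _ hv => mem_tightKernel.2 fun i hi => mem_tightKernel.1 hv i (h hi)

/-- The constraints tight at a midpoint are those tight at both ends. -/
lemma tight_midpoint_iff {x y : V} (hx : ∀ i, a i x ≤ β i) (hy : ∀ i, a i y ≤ β i) (i : ι) :
    a i ((1 / 2 : ℝ) • (x + y)) = β i ↔ a i x = β i ∧ a i y = β i := by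
  simp only [map_smul, map_add, smul_eq_mul]
  have h1 := hx i
  have h2 := hy i
  constructor
  · intro h
    constructor <;> linarith
  · rintro ⟨h3, h4⟩
    linarith

lemma feasible_midpoint {x y : V} (hx : ∀ i, a i x ≤ β i) (hy : ∀ i, a i y ≤ β i) (i : ι) :
    a i ((1 / 2 : ℝ) • (x + y)) ≤ β i := by
  simp only [map_smul, map_add, smul_eq_mul]
  linarith [hx i, hy i]

lemma IsTightSet.inter {J K : Set ι} (hJ : IsTightSet a β J) (hK : IsTightSet a β K) :
    IsTightSet a β (J ∩ K) := by
  obtain ⟨x, hx, hxJ⟩ := hJ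
  obtain ⟨y, hy, hyK⟩ := hK
  exact ⟨_, feasible_midpoint hx hy, fun i => by
    rw [tight_midpoint_iff hx hy, Set.mem_inter_iff, hxJ, hyK]⟩

/-- A feasible point can be moved a little in every direction that does not increase the tight
constraints. -/
lemma exists_pos_feasible [Finite ι] {x v : V} (hx : ∀ i, a i x ≤ β i)
    (hv : ∀ i, a i x = β i → a i v ≤ 0) : ∃ ε : ℝ, 0 < ε ∧ ∀ i, a i (x + ε • v) ≤ β i := by
  have key : ∀ᶠ ε : ℝ in nhdsWithin 0 (Set.Ioi 0), ∀ i, a i (x + ε • v) ≤ β i := by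
    rw [Filter.eventually_all]
    intro i
    rcases eq_or_lt_of_le (hx i) with h | h
    · filter_upwards [self_mem_nhdsWithin] with ε hε
      have := mul_nonpos_of_nonneg_of_nonpos (le_of_lt hε) (hv i h)
      simp only [map_add, map_smul, smul_eq_mul]
      linarith
    · have hc : Filter.Tendsto (fun ε : ℝ => a i (x + ε • v)) (nhdsWithin 0 (Set.Ioi 0))
          (nhds (a i (x + (0 : ℝ) • v))) := by
        refine Filter.Tendsto.mono_left (Continuous.tendsto ?_ 0) nhdsWithin_le_nhds
        simp only [map_add, map_smul, smul_eq_mul]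
        fun_prop
      have h' : a i (x + (0 : ℝ) • v) < β i := by simpa using h
      filter_upwards [hc.eventually (gt_mem_nhds h')] with ε hε using hε.le
  obtain ⟨ε, h1, h2⟩ := (key.and self_mem_nhdsWithin).exists
  exact ⟨ε, h2, h1⟩

end TightSets

/-! ### Faces correspond to tight sets -/

section Faces

variable {ι : Type*} [Finite ι] {d : ℕ} {a : ι → (Fin d → ℝ) →ₗ[ℝ] ℝ} {β : ι → ℝ}

/-- The witness of `IsTightSet` has slack in every constraint outside `J`, so it can be moved within
the face along any direction of the kernel. -/
lemma vectorSpan_tight {J : Set ι} (hJ : IsTightSet a β J) :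
    vectorSpan ℝ {x | (∀ i, a i x ≤ β i) ∧ ∀ i ∈ J, a i x = β i} = tightKernel a J := by
  obtain ⟨x, hx, hxJ⟩ := hJ
  apply le_antisymm
  · rw [vectorSpan_def, Submodule.span_le]
    rintro _ ⟨y, hy, z, hz, rfl⟩
    refine mem_tightKernel.2 fun i hi => ?_
    simp [hy.2 i hi, hz.2 i hi]
  · intro v hv
    rw [mem_tightKernel] at hv
    obtain ⟨ε, hε, h⟩ := exists_pos_feasible hx (v := v) fun i hi => (hv i ((hxJ i).2 hi)).le
    have h1 : (x + ε • v) -ᵥ x ∈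
        vectorSpan ℝ {x | (∀ i, a i x ≤ β i) ∧ ∀ i ∈ J, a i x = β i} :=
      vsub_mem_vectorSpan ℝ
        ⟨h, fun i hi => by simp [hv i hi, (hxJ i).1 hi]⟩ ⟨hx, fun i hi => (hxJ i).1 hi⟩
    have h2 := Submodule.smul_mem _ ε⁻¹ h1
    simpa [smul_smul, hε.ne'] using h2

/-- The sum of the functionals in `J` exposes the face: on feasible points it is at most the sum of
the `β i`, with equality only if every summand is tight. -/
lemma isExposed_tight (J : Set ι) :
    IsExposed ℝ {x | ∀ i, a i x ≤ β i} {x | (∀ i, a i x ≤ β i) ∧ ∀ i ∈ J, a i x = β i} := by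
  classical
  have := Fintype.ofFinite ι
  rintro ⟨x, hx, hxJ⟩
  have e : ∀ y, (LinearMap.toContinuousLinearMap (∑ i ∈ J.toFinset, a i)) y
      = ∑ i ∈ J.toFinset, a i y := by intro y; simp
  refine ⟨LinearMap.toContinuousLinearMap (∑ i ∈ J.toFinset, a i), ?_⟩
  ext y
  simp only [Set.mem_ofPred_eq, e]
  refine and_congr_right fun hy => ⟨fun h z hz => ?_, fun h => ?_⟩
  · exact Finset.sum_le_sum fun i hi => (hz i).trans (h i (by simpa using hi)).ge
  · have h1 : ∑ i ∈ J.toFinset, a i y = ∑ i ∈ J.toFinset, β i := by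
      refine le_antisymm (Finset.sum_le_sum fun i _ => hy i) ?_
      refine le_trans (Finset.sum_le_sum fun i hi => ?_) (h x hx)
      exact (hxJ i (by simpa using hi)).ge
    intro i hi
    exact (Finset.sum_eq_sum_iff_of_le (fun i _ => hy i)).1 h1 i (by simpa using hi)

/-- A maximizer `z` with minimal tight set plays the role of a relative interior point. Its midpoint
with another maximizer is again one, so by minimality that maximizer is tight on `J`. Conversely, if
`y` is tight on `J`, then `z` can be moved slightly away from `y`; maximality of `z` then forces `l
z ≤ l y`. -/
lemma exists_tight_of_isExposed {F : Set (Fin d → ℝ)}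
    (hF : IsExposed ℝ {x | ∀ i, a i x ≤ β i} F) (hne : F.Nonempty) :
    ∃ J, IsTightSet a β J ∧ F = {x | (∀ i, a i x ≤ β i) ∧ ∀ i ∈ J, a i x = β i} := by
  obtain ⟨l, rfl⟩ := hF hne
  obtain ⟨z, hz, hmin⟩ := exists_minimalFor_of_wellFoundedLT
    (fun x => x ∈ {x | x ∈ {x | ∀ i, a i x ≤ β i} ∧ ∀ y ∈ {x | ∀ i, a i x ≤ β i}, l y ≤ l x})
    (fun x => {i | a i x = β i}) hne
  refine ⟨{i | a i z = β i}, ⟨z, hz.1, fun i => Iff.rfl⟩, ?_⟩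
  ext y
  constructor
  · rintro ⟨hy, hyl⟩
    refine ⟨hy, fun i hi => ?_⟩
    have hm : ∀ w ∈ {x | ∀ i, a i x ≤ β i}, l w ≤ l ((1 / 2 : ℝ) • (z + y)) := by
      intro w hw
      have h1 := hz.2 w hw
      have h2 := hyl w hw
      simp only [map_smul, map_add, smul_eq_mul]
      linarith
    have h := @hmin ((1 / 2 : ℝ) • (z + y)) ⟨feasible_midpoint hz.1 hy, hm⟩
      (fun i hi => ((tight_midpoint_iff hz.1 hy i).1 hi).1)
    exact ((tight_midpoint_iff hz.1 hy i).1 (h hi)).2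
  · rintro ⟨hy, hyJ⟩
    refine ⟨hy, fun w hw => (hz.2 w hw).trans ?_⟩
    obtain ⟨ε, hε, h⟩ := exists_pos_feasible hz.1 (v := z - y) fun i hi => by
      simp [hi, hyJ i hi]
    have h1 := hz.2 _ h
    simp only [map_add, map_smul, map_sub, smul_eq_mul] at h1
    nlinarith

/-- The `k`-faces of a polyhedron correspond to the tight sets of its constraints. -/
lemma faceNumber_eq_ncard_tightSets (a : ι → (Fin d → ℝ) →ₗ[ℝ] ℝ) (β : ι → ℝ) (k : ℕ) :
    faceNumber {x | ∀ i, a i x ≤ β i} k = (tightSets a β k).ncard := by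
  have him : kFaces {x | ∀ i, a i x ≤ β i} k =
      (fun J => {x | (∀ i, a i x ≤ β i) ∧ ∀ i ∈ J, a i x = β i}) '' tightSets a β k := by
    ext F
    constructor
    · rintro ⟨hne, hF, hk⟩
      obtain ⟨J, hJ, rfl⟩ := exists_tight_of_isExposed hF hne
      exact ⟨J, ⟨hJ, by rwa [← vectorSpan_tight hJ]⟩, rfl⟩
    · rintro ⟨J, ⟨hJ, hk⟩, rfl⟩
      refine ⟨?_, isExposed_tight J, by rwa [vectorSpan_tight hJ]⟩
      obtain ⟨x, hx, hxJ⟩ := hJ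
      exact ⟨x, hx, fun i hi => (hxJ i).1 hi⟩
  rw [faceNumber, him, Set.InjOn.ncard_image]
  -- Injectivity: a point whose tight set is exactly `J` lies in the face, so every constraint that
  -- is tight on the face belongs to `J`.
  have key : ∀ J K, IsTightSet a β J →
      {x | (∀ i, a i x ≤ β i) ∧ ∀ i ∈ J, a i x = β i} =
        {x | (∀ i, a i x ≤ β i) ∧ ∀ i ∈ K, a i x = β i} → K ⊆ J := by
    rintro J K ⟨x, hx, hxJ⟩ h i hi
    have : x ∈ {x | (∀ i, a i x ≤ β i) ∧ ∀ i ∈ J, a i x = β i} :=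
      ⟨hx, fun i hi => (hxJ i).1 hi⟩
    rw [h] at this
    exact (hxJ i).2 (this.2 i hi)
  intro J hJ K hK h
  exact (key K J hK.1 h.symm).antisymm (key J K hJ.1 h)

end Faces

/-! ### Face polynomials and products -/

/-- The generating polynomial of the face numbers of the polyhedron `a i x ≤ β i`. -/
noncomputable def facePoly {ι V : Type*} [AddCommGroup V] [Module ℝ V] [Fintype ι]
    (a : ι → V →ₗ[ℝ] ℝ) (β : ι → ℝ) : ℕ[X] :=
  open Classical in ∑ J with IsTightSet a β J, X ^ Module.finrank ℝ (tightKernel a J)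

section FacePoly

variable {ι κ V W : Type*} [AddCommGroup V] [Module ℝ V] [AddCommGroup W] [Module ℝ W]

lemma coeff_facePoly [Fintype ι] (a : ι → V →ₗ[ℝ] ℝ) (β : ι → ℝ) (k : ℕ) :
    (facePoly a β).coeff k = (tightSets a β k).ncard := by
  classical
  rw [facePoly, finsetSum_coeff]
  simp only [coeff_X_pow]
  rw [Finset.sum_boole, Finset.filter_filter, ← Set.ncard_coe_finset]
  simp only [Nat.cast_id]
  congr 1
  ext J
  simp [tightSets, eq_comm]

lemma facePoly_comp_linearEquiv [Fintype ι] (a : ι → V →ₗ[ℝ] ℝ) (β : ι → ℝ) (e : W ≃ₗ[ℝ] V) :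
    facePoly (fun i => a i ∘ₗ e.toLinearMap) β = facePoly a β := by
  classical
  have h1 : ∀ J, IsTightSet (fun i => a i ∘ₗ e.toLinearMap) β J ↔ IsTightSet a β J := by
    intro J
    constructor
    · rintro ⟨x, hx⟩
      exact ⟨e x, hx⟩
    · rintro ⟨x, hx⟩
      exact ⟨e.symm x, by simpa using hx⟩
  have h2 : ∀ J, Module.finrank ℝ (tightKernel (fun i => a i ∘ₗ e.toLinearMap) J) =
      Module.finrank ℝ (tightKernel a J) := by
    intro J
    have : tightKernel a J = (tightKernel (fun i => a i ∘ₗ e.toLinearMap) J).map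
        e.toLinearMap := by
      ext v
      rw [Submodule.mem_map_equiv]
      simp [mem_tightKernel]
    rw [this, LinearEquiv.finrank_map_eq]
  simp only [facePoly, h1, h2]

/-- The system of a product of polyhedra. -/
def prodSystem (a : ι → V →ₗ[ℝ] ℝ) (b : κ → W →ₗ[ℝ] ℝ) : ι ⊕ κ → (V × W) →ₗ[ℝ] ℝ :=
  Sum.elim (fun i => a i ∘ₗ LinearMap.fst ℝ V W) (fun j => b j ∘ₗ LinearMap.snd ℝ V W)

lemma isTightSet_prodSystem {a : ι → V →ₗ[ℝ] ℝ} {b : κ → W →ₗ[ℝ] ℝ} {β : ι → ℝ} {γ : κ → ℝ}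
    {J : Set (ι ⊕ κ)} : IsTightSet (prodSystem a b) (Sum.elim β γ) J ↔
      IsTightSet a β (Sum.inl ⁻¹' J) ∧ IsTightSet b γ (Sum.inr ⁻¹' J) := by
  constructor
  · rintro ⟨⟨x, y⟩, h1, h2⟩
    exact ⟨⟨x, fun i => h1 (Sum.inl i), fun i => h2 (Sum.inl i)⟩,
      ⟨y, fun i => h1 (Sum.inr i), fun i => h2 (Sum.inr i)⟩⟩
  · rintro ⟨⟨x, h1, h2⟩, ⟨y, h3, h4⟩⟩
    exact ⟨(x, y), Sum.rec h1 h3, Sum.rec h2 h4⟩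

lemma finrank_tightKernel_prodSystem [FiniteDimensional ℝ V] [FiniteDimensional ℝ W]
    (a : ι → V →ₗ[ℝ] ℝ) (b : κ → W →ₗ[ℝ] ℝ) (J : Set (ι ⊕ κ)) :
    Module.finrank ℝ (tightKernel (prodSystem a b) J) =
      Module.finrank ℝ (tightKernel a (Sum.inl ⁻¹' J)) +
        Module.finrank ℝ (tightKernel b (Sum.inr ⁻¹' J)) := by
  have : tightKernel (prodSystem a b) J =
      (tightKernel a (Sum.inl ⁻¹' J)).prod (tightKernel b (Sum.inr ⁻¹' J)) := by
    ext ⟨x, y⟩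
    simp [mem_tightKernel, prodSystem]
  rw [this, ← Module.finrank_prod]
  exact LinearEquiv.finrank_eq
    { toFun := fun x => (⟨x.1.1, x.2.1⟩, ⟨x.1.2, x.2.2⟩)
      invFun := fun y => ⟨(y.1.1, y.2.1), y.1.2, y.2.2⟩
      map_add' := fun _ _ => rfl
      map_smul' := fun _ _ => rfl
      left_inv := fun _ => rfl
      right_inv := fun _ => rfl }

/-- A tight set of the product is an independent choice of a tight set in each factor, and the
dimensions, which are the exponents, add. -/
lemma facePoly_prodSystem [Fintype ι] [Fintype κ] [FiniteDimensional ℝ V] [FiniteDimensional ℝ W]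
    (a : ι → V →ₗ[ℝ] ℝ) (b : κ → W →ₗ[ℝ] ℝ) (β : ι → ℝ) (γ : κ → ℝ) :
    facePoly (prodSystem a b) (Sum.elim β γ) = facePoly a β * facePoly b γ := by
  classical
  rw [facePoly, facePoly, facePoly, Finset.sum_mul_sum, ← Finset.sum_product']
  refine Finset.sum_bij' (fun J _ => (Sum.inl ⁻¹' J, Sum.inr ⁻¹' J))
    (fun p _ => Sum.inl '' p.1 ∪ Sum.inr '' p.2) ?_ ?_ ?_ ?_ ?_
  · intro J hJ
    simpa [isTightSet_prodSystem] using hJ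
  · rintro ⟨J, K⟩ h
    simpa [isTightSet_prodSystem, Set.preimage_image_eq _ Sum.inl_injective,
      Set.preimage_image_eq _ Sum.inr_injective] using h
  · intro J _
    ext (i | i) <;> simp
  · rintro ⟨J, K⟩ h
    ext i <;> simp
  · intro J _
    rw [finrank_tightKernel_prodSystem, pow_add]

/-- The system of a finite product of polyhedra. -/
def piSystem {α : Type*} (a : α → ι → V →ₗ[ℝ] ℝ) : α × ι → (α → V) →ₗ[ℝ] ℝ :=
  fun p => a p.1 p.2 ∘ₗ LinearMap.proj p.1

lemma isTightSet_piSystem {α : Type*} {a : α → ι → V →ₗ[ℝ] ℝ} {β : α → ι → ℝ}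
    {J : Set (α × ι)} : IsTightSet (piSystem a) (fun p => β p.1 p.2) J ↔
      ∀ s, IsTightSet (a s) (β s) (Prod.mk s ⁻¹' J) := by
  constructor
  · rintro ⟨x, h1, h2⟩ s
    exact ⟨x s, fun i => h1 (s, i), fun i => h2 (s, i)⟩
  · intro h
    choose x h1 h2 using h
    exact ⟨x, fun p => h1 p.1 p.2, fun p => h2 p.1 p.2⟩

lemma finrank_tightKernel_piSystem {α : Type*} [Fintype α] [FiniteDimensional ℝ V]
    (a : α → ι → V →ₗ[ℝ] ℝ) (J : Set (α × ι)) :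
    Module.finrank ℝ (tightKernel (piSystem a) J) =
      ∑ s, Module.finrank ℝ (tightKernel (a s) (Prod.mk s ⁻¹' J)) := by
  have hmem : ∀ x : α → V, x ∈ tightKernel (piSystem a) J ↔
      ∀ s, x s ∈ tightKernel (a s) (Prod.mk s ⁻¹' J) := by
    intro x
    simp [mem_tightKernel, piSystem]
  rw [← Module.finrank_pi_fintype]
  exact LinearEquiv.finrank_eq
    { toFun := fun x s => ⟨x.1 s, (hmem x.1).1 x.2 s⟩
      invFun := fun y => ⟨fun s => (y s).1, (hmem _).2 fun s => (y s).2⟩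
      map_add' := fun _ _ => rfl
      map_smul' := fun _ _ => rfl
      left_inv := fun _ => rfl
      right_inv := fun _ => rfl }

lemma facePoly_piSystem {α : Type*} [Fintype α] [Fintype ι] [FiniteDimensional ℝ V]
    (a : α → ι → V →ₗ[ℝ] ℝ) (β : α → ι → ℝ) :
    facePoly (piSystem a) (fun p => β p.1 p.2) = ∏ s, facePoly (a s) (β s) := by
  classical
  simp only [facePoly]
  rw [Finset.prod_univ_sum]
  refine Finset.sum_bij' (fun J _ s => Prod.mk s ⁻¹' J) (fun f _ => {p | p.2 ∈ f p.1})
    ?_ ?_ ?_ ?_ ?_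
  · intro J hJ
    simpa [isTightSet_piSystem] using hJ
  · intro f hf
    simpa [isTightSet_piSystem] using hf
  · intro J _
    ext p
    simp
  · intro f _
    ext s i
    simp
  · intro J _
    rw [finrank_tightKernel_piSystem, Finset.prod_pow_eq_pow_sum]

end FacePoly

/-! ### Half-lines and polygons -/

/-- The face polynomial of a half-line. -/
lemma facePoly_halfLine :
    facePoly (fun _ : Unit => -(LinearMap.id : ℝ →ₗ[ℝ] ℝ)) (fun _ => 0) = 1 + X := by
  classical
  have h : ∀ J : Set Unit,
      IsTightSet (fun _ : Unit => -(LinearMap.id : ℝ →ₗ[ℝ] ℝ)) (fun _ => 0) J := by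
    intro J
    by_cases hJ : () ∈ J
    · exact ⟨0, by simp, fun i => by simpa using hJ⟩
    · exact ⟨1, by simp, fun i => by simpa using hJ⟩
  have e : (Finset.univ : Finset (Set Unit)) = {∅, Set.univ} := by
    ext J
    simp only [Finset.mem_univ, Finset.mem_insert, Finset.mem_singleton, true_iff]
    exact Set.eq_empty_or_nonempty J |>.imp id fun ⟨x, hx⟩ =>
      Set.eq_univ_of_forall fun y => by rwa [Subsingleton.elim y x]
  have h0 : tightKernel (fun _ : Unit => -(LinearMap.id : ℝ →ₗ[ℝ] ℝ)) ∅ = ⊤ := by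
    ext v; simp [mem_tightKernel]
  have h1 : tightKernel (fun _ : Unit => -(LinearMap.id : ℝ →ₗ[ℝ] ℝ)) Set.univ = ⊥ := by
    ext v; simp [mem_tightKernel]
  simp only [facePoly, h, Finset.filter_true, e]
  rw [Finset.sum_pair Set.empty_ne_univ, h0, h1]
  simp [add_comm]

section Polygon

variable {ι V : Type*} [AddCommGroup V] [Module ℝ V]
  {a : ι → V →ₗ[ℝ] ℝ} {β : ι → ℝ}

/-- A vertex does not lie strictly between two distinct feasible points. -/
lemma vertex_not_between {x y : V} {J : Set ι} (hx : ∀ i, a i x ≤ β i)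
    (hy : ∀ i, a i y ≤ β i) (hJ : tightKernel a J = ⊥) {θ : ℝ} (h0 : 0 < θ) (h1 : θ < 1)
    (hxy : ∀ i ∈ J, a i (x + θ • (y - x)) = β i) : x = y := by
  have : y - x ∈ tightKernel a J := by
    refine mem_tightKernel.2 fun i hi => ?_
    have h2 := hxy i hi
    have h3 := hx i
    have h4 := hy i
    simp only [map_add, map_smul, map_sub, smul_eq_mul] at h2 ⊢
    nlinarith
  rw [hJ, Submodule.mem_bot, sub_eq_zero] at this
  exact this.symm

lemma IsTightSet.eq_of_point {x : V} {J K : Set ι} (hJ : ∀ i, i ∈ J ↔ a i x = β i)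
    (hK : ∀ i, i ∈ K ↔ a i x = β i) : J = K := by
  ext i
  rw [hJ, hK]

lemma finrank_ker_of_ne_zero [FiniteDimensional ℝ V] (hV : Module.finrank ℝ V = 2)
    {f : V →ₗ[ℝ] ℝ} (hf : f ≠ 0) : Module.finrank ℝ (LinearMap.ker f) = 1 := by
  have h1 := LinearMap.finrank_range_add_finrank_ker f
  have h2 : LinearMap.range f = ⊤ := LinearMap.range_eq_top.2 (LinearMap.surjective hf)
  rw [h2, finrank_top, Module.finrank_self] at h1
  omega

/-- At most two vertices lie on a line. -/
lemma card_vertices_on_line_le [FiniteDimensional ℝ V] [DecidableEq (Set ι)] (hV : Module.finrank ℝ V = 2) {j : ι}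
    (hj : a j ≠ 0) (S : Finset (Set ι)) (hS : ∀ J ∈ S, J ∈ tightSets a β 0 ∧ j ∈ J) :
    S.card ≤ 2 := by
  by_contra! hcard
  have hker := finrank_ker_of_ne_zero hV hj
  obtain ⟨⟨u, hu⟩, hu0, huspan⟩ := finrank_eq_one_iff'.1 hker
  -- parametrize the line
  obtain ⟨J₀, hJ₀⟩ : S.Nonempty := Finset.card_pos.1 (by omega)
  have hpt : ∀ J ∈ S, ∃ x, (∀ i, a i x ≤ β i) ∧ ∀ i, i ∈ J ↔ a i x = β i :=
    fun J hJ => (hS J hJ).1.1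
  choose! x hx hxJ using hpt
  have hpar : ∀ J ∈ S, ∃ c : ℝ, x J = x J₀ + c • u := by
    intro J hJ
    have h1 : x J - x J₀ ∈ LinearMap.ker (a j) := by
      rw [LinearMap.mem_ker, map_sub, (hxJ J hJ j).1 (hS J hJ).2,
        (hxJ J₀ hJ₀ j).1 (hS J₀ hJ₀).2, sub_self]
    obtain ⟨c, hc⟩ := huspan ⟨_, h1⟩
    refine ⟨c, ?_⟩
    have := congrArg Subtype.val hc
    simp only [Submodule.coe_smul] at this
    rw [this]
    abel
  choose! c hc using hpar
  have hinj : Set.InjOn c S := by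
    intro J hJ K hK h
    refine IsTightSet.eq_of_point (hxJ J hJ) ?_
    rw [hc J hJ, h, ← hc K hK]
    exact hxJ K hK
  -- Of three vertices on a line the middle one would lie strictly between the other two, which
  -- `vertex_not_between` forbids. The cases at the end run through the orders of the parameters.
  have hbetween : ∀ J ∈ S, ∀ K ∈ S, ∀ L ∈ S, c J < c K → c K < c L → False := by
    intro J hJ K hK L hL h1 h2
    have hK0 : tightKernel a K = ⊥ := Submodule.finrank_eq_zero.1 (hS K hK).1.2
    have heq : x J = x L := by
      refine vertex_not_between (hx J hJ) (hx L hL) hK0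
        (θ := (c K - c J) / (c L - c J)) (div_pos (by linarith) (by linarith))
        ((div_lt_one (by linarith)).2 (by linarith)) fun i hi => ?_
      have : x J + ((c K - c J) / (c L - c J)) • (x L - x J) = x K := by
        have h3 : c L - c J ≠ 0 := by linarith
        have h4 : x L - x J = (c L - c J) • u := by
          rw [hc J hJ, hc L hL, sub_smul]
          abel
        rw [h4, smul_smul, div_mul_cancel₀ _ h3, hc J hJ, hc K hK, sub_smul]
        abel
      rw [this]
      exact (hxJ K hK i).1 hi
    have : J = L := by
      refine IsTightSet.eq_of_point (hxJ J hJ) ?_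
      rw [heq]
      exact hxJ L hL
    rw [this] at h1
    linarith
  obtain ⟨J, hJ, K, hK, L, hL, h1, h2, h3⟩ := Finset.two_lt_card.1 hcard
  have e1 : c J ≠ c K := fun h => h1 (hinj hJ hK h)
  have e2 : c J ≠ c L := fun h => h2 (hinj hJ hL h)
  have e3 : c K ≠ c L := fun h => h3 (hinj hK hL h)
  rcases lt_or_gt_of_ne e1 with h | h <;> rcases lt_or_gt_of_ne e2 with h' | h' <;>
    rcases lt_or_gt_of_ne e3 with h'' | h''
  · exact hbetween J hJ K hK L hL h h''
  · exact hbetween J hJ L hL K hK h' h''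
  · linarith
  · exact hbetween L hL J hJ K hK h' h
  · exact hbetween K hK J hJ L hL h h'
  · linarith
  · exact hbetween K hK L hL J hJ h'' h'
  · exact hbetween L hL K hK J hJ h'' h

/-- A vertex lies on at least two proper constraint lines. -/
lemma two_le_card_tight [FiniteDimensional ℝ V] [Fintype ι] (hV : Module.finrank ℝ V = 2)
    {J : Set ι} (hJ : Module.finrank ℝ (tightKernel a J) = 0) [DecidableEq ι]
    [DecidablePred (· ∈ J)] [DecidablePred fun j => a j ≠ 0] :
    2 ≤ ({j ∈ ({j | a j ≠ 0} : Finset ι) | j ∈ J}).card := by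
  by_contra! h
  have hJ' := Submodule.finrank_eq_zero.1 hJ
  have hmem : ∀ v, (∀ j ∈ ({j ∈ ({j | a j ≠ 0} : Finset ι) | j ∈ J}), a j v = 0) → v = 0 := by
    intro v hv
    have : v ∈ tightKernel a J := by
      refine mem_tightKernel.2 fun i hi => ?_
      by_cases h0 : a i = 0
      · simp [h0]
      · exact hv i (by simp [h0, hi])
    rwa [hJ', Submodule.mem_bot] at this
  -- If at most one proper line passed through the vertex, a single functional `f` (zero or `a j`)
  -- would have trivial kernel on a plane.
  have key : ∀ f : V →ₗ[ℝ] ℝ,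
      (∀ v, f v = 0 → ∀ j ∈ ({j ∈ ({j | a j ≠ 0} : Finset ι) | j ∈ J}), a j v = 0) → False := by
    intro f hf
    have hbot : LinearMap.ker f = ⊥ := by
      rw [LinearMap.ker_eq_bot']
      exact fun v hv => hmem v (hf v hv)
    have h1 := LinearMap.finrank_range_add_finrank_ker f
    have h2 := Submodule.finrank_le (LinearMap.range f)
    rw [hbot, finrank_bot] at h1
    rw [Module.finrank_self] at h2
    omega
  rcases Finset.eq_empty_or_nonempty ({j ∈ ({j | a j ≠ 0} : Finset ι) | j ∈ J}) with he | ⟨j, hj⟩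
  · exact key 0 fun v _ j hj => by simp [he] at hj
  · refine key (a j) fun v hv i hi => ?_
    rwa [Finset.card_le_one.1 (Nat.lt_succ_iff.1 h) i hi j hj]

/-- The face polynomial of a polygon with as many vertices as constraints. -/
lemma facePoly_polygon [FiniteDimensional ℝ V] [Fintype ι] (hV : Module.finrank ℝ V = 2)
    (hq : 3 ≤ Fintype.card ι) (h0 : (tightSets a β 0).ncard = Fintype.card ι) :
    facePoly a β = C (Fintype.card ι) * (1 + X) + X ^ 2 := by
  classical
  set T : Finset (Set ι) := (tightSets a β 0).toFinset with hT
  have hTmem : ∀ J, J ∈ T ↔ J ∈ tightSets a β 0 := fun J => by simp [hT]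
  have hTcard : T.card = Fintype.card ι := by
    rw [← h0, Set.ncard_eq_toFinset_card', hT]
  set Z : Finset ι := {j | a j ≠ 0} with hZ
  -- Double counting of incidences between vertices and proper constraint lines: each vertex is on
  -- at least two lines, each line carries at most two vertices, and there are as many vertices as
  -- constraints. Hence equality holds throughout and no `a j` is zero.
  have hlow : ∀ J ∈ T, 2 ≤ (Z.bipartiteAbove (fun J j => j ∈ J) J).card := fun J hJ =>
    two_le_card_tight hV ((hTmem J).1 hJ).2
  have hupp : ∀ j ∈ Z, (T.bipartiteBelow (fun J j => j ∈ J) j).card ≤ 2 := by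
    intro j hj
    refine card_vertices_on_line_le (β := β) hV (by simpa [hZ] using hj) _ fun J hJ => ?_
    rw [Finset.mem_bipartiteBelow, hTmem] at hJ
    exact hJ
  have hdc := Finset.sum_card_bipartiteAbove_eq_sum_card_bipartiteBelow
    (s := T) (t := Z) (fun J j => j ∈ J)
  have h1 := Finset.sum_le_sum hlow
  have h2 := Finset.sum_le_sum hupp
  simp only [Finset.sum_const, smul_eq_mul] at h1 h2
  have h3 : Z.card ≤ Fintype.card ι := Finset.card_le_univ _
  have hZcard : Z.card = Fintype.card ι := by omega
  have hZuniv : Z = Finset.univ := (Finset.card_eq_iff_eq_univ Z).1 hZcard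
  have hne : ∀ j, a j ≠ 0 := fun j => by
    have : j ∈ Z := hZuniv ▸ Finset.mem_univ j
    simpa [hZ] using this
  have hJ2 : ∀ J ∈ T, 2 = (Z.bipartiteAbove (fun J j => j ∈ J) J).card := by
    refine (Finset.sum_eq_sum_iff_of_le hlow).1 ?_
    simp only [Finset.sum_const, smul_eq_mul]
    omega
  have hj2 : ∀ j ∈ Z, (T.bipartiteBelow (fun J j => j ∈ J) j).card = 2 := by
    refine (Finset.sum_eq_sum_iff_of_le hupp).1 ?_
    simp only [Finset.sum_const, smul_eq_mul]
    omega
  have hJcard : ∀ J ∈ tightSets a β 0, J.ncard = 2 := by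
    intro J hJ
    rw [hJ2 J ((hTmem J).2 hJ), Set.ncard_eq_toFinset_card']
    congr 1
    ext j
    simp [Finset.mem_bipartiteAbove, hZuniv]
  have hker : ∀ j, tightKernel a {j} = LinearMap.ker (a j) := fun j => by
    simp [tightKernel]
  have hempty : tightKernel a ∅ = ⊤ := by simp [tightKernel]
  have hpair : ∀ j, ∃ J ∈ tightSets a β 0, ∃ K ∈ tightSets a β 0, J ≠ K ∧ j ∈ J ∧ j ∈ K := by
    intro j
    obtain ⟨J, K, hne, h⟩ := Finset.card_eq_two.1 (hj2 j (hZuniv ▸ Finset.mem_univ j))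
    have hJ : J ∈ T.bipartiteBelow (fun J j => j ∈ J) j := by simp [h]
    have hK : K ∈ T.bipartiteBelow (fun J j => j ∈ J) j := by simp [h]
    rw [Finset.mem_bipartiteBelow, hTmem] at hJ hK
    exact ⟨J, hJ.1, K, hK.1, hne, hJ.2, hK.2⟩
  -- The two vertices on line `j` have distinct two-element tight sets containing `j`, so these meet
  -- exactly in `{j}`; tight sets are closed under intersection.
  have hsingle : ∀ j, IsTightSet a β {j} := by
    intro j
    obtain ⟨J, hJ, K, hK, hne, hjJ, hjK⟩ := hpair j
    have hint : J ∩ K = {j} := by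
      refine (Set.eq_singleton_iff_unique_mem.2 ⟨⟨hjJ, hjK⟩, fun i hi => ?_⟩)
      by_contra hij
      have hsub : ({i, j} : Set ι) ⊆ J ∩ K := by
        rintro x (rfl | rfl)
        exacts [hi, ⟨hjJ, hjK⟩]
      have hc : ({i, j} : Set ι).ncard = 2 := Set.ncard_pair hij
      have e1 := Set.eq_of_subset_of_ncard_le (hsub.trans Set.inter_subset_left)
        (by rw [hc, hJcard J hJ]) (Set.toFinite _)
      have e2 := Set.eq_of_subset_of_ncard_le (hsub.trans Set.inter_subset_right)
        (by rw [hc, hJcard K hK]) (Set.toFinite _)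
      exact hne (e1.symm.trans e2)
    rw [← hint]
    exact hJ.1.inter hK.1
  have hemptyT : IsTightSet a β ∅ := by
    obtain ⟨i, j, hij⟩ := Fintype.exists_pair_of_one_lt_card (α := ι) (by omega)
    have := (hsingle i).inter (hsingle j)
    rwa [Set.singleton_inter_eq_empty.2 (by simpa using hij)] at this
  have hT1 : tightSets a β 1 = Set.range fun j => ({j} : Set ι) := by
    ext J
    constructor
    · rintro ⟨hJ, hJ1⟩
      have hJne : J.Nonempty := by
        rw [Set.nonempty_iff_ne_empty]
        rintro rfl
        rw [hempty, finrank_top] at hJ1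
        omega
      obtain ⟨j, hj⟩ := hJne
      refine ⟨j, (Set.eq_singleton_iff_unique_mem.2 ⟨hj, fun i hi => ?_⟩).symm⟩
      -- A second constraint `i` tight along this edge would be parallel to `j`. A vertex `K` on
      -- line `j` is then also on line `i`, so `K = {i, j}` and its kernel would contain the
      -- one-dimensional kernel of `J`.
      by_contra hij
      have hle : tightKernel a J ≤ tightKernel a {j} :=
        tightKernel_anti (Set.singleton_subset_iff.2 hj)
      have heq : tightKernel a J = tightKernel a {j} :=
        Submodule.eq_of_le_of_finrank_eq hle (by rw [hJ1, hker, finrank_ker_of_ne_zero hV (hne j)])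
      obtain ⟨K, hK, -, -, -, hjK, -⟩ := hpair j
      obtain ⟨x, hx, hxJ⟩ := hJ
      obtain ⟨y, hy, hyK⟩ := id hK.1
      have hyx : y - x ∈ tightKernel a J := by
        rw [heq]
        refine mem_tightKernel.2 ?_
        rintro _ rfl
        rw [map_sub, (hyK _).1 hjK, (hxJ _).1 hj, sub_self]
      have hiK : i ∈ K := by
        rw [hyK, ← (hxJ i).1 hi]
        have := mem_tightKernel.1 hyx i hi
        rwa [map_sub, sub_eq_zero] at this
      have hsub : ({i, j} : Set ι) ⊆ K := by
        rintro x (rfl | rfl)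
        exacts [hiK, hjK]
      have e1 := Set.eq_of_subset_of_ncard_le hsub
        (by rw [Set.ncard_pair hij, hJcard K hK]) (Set.toFinite _)
      have hbot : tightKernel a K = ⊥ := Submodule.finrank_eq_zero.1 hK.2
      have hle' : tightKernel a J ≤ tightKernel a K := by
        rw [heq, ← e1]
        intro v hv
        refine mem_tightKernel.2 ?_
        rintro l (rfl | rfl)
        · exact mem_tightKernel.1 (heq ▸ hv) _ hi
        · exact mem_tightKernel.1 hv _ rfl
      rw [hbot, le_bot_iff] at hle'
      rw [hle', finrank_bot] at hJ1
      omega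
    · rintro ⟨j, rfl⟩
      exact ⟨hsingle j, by rw [hker, finrank_ker_of_ne_zero hV (hne j)]⟩
  have hT2 : tightSets a β 2 = {∅} := by
    ext J
    simp only [Set.mem_singleton_iff]
    constructor
    · rintro ⟨-, h2⟩
      by_contra hJ
      obtain ⟨j, hj⟩ := Set.nonempty_iff_ne_empty.2 hJ
      have hle := Submodule.finrank_mono
        (tightKernel_anti (a := a) (Set.singleton_subset_iff.2 hj))
      rw [h2, hker, finrank_ker_of_ne_zero hV (hne j)] at hle
      omega
    · rintro rfl
      exact ⟨hemptyT, by rw [hempty, finrank_top, hV]⟩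
  ext k
  rw [coeff_facePoly]
  match k with
  | 0 => simp [h0]
  | 1 =>
    rw [hT1, Set.ncard_range_of_injective Set.singleton_injective, Nat.card_eq_fintype_card]
    simp [coeff_one]
  | 2 =>
    rw [hT2]
    simp [coeff_one, coeff_X]
  | k + 3 =>
    have : tightSets a β (k + 3) = ∅ := by
      ext J
      simp only [Set.mem_empty_iff_false, iff_false]
      rintro ⟨-, h⟩
      have := Submodule.finrank_le (tightKernel a J)
      omega
    rw [this]
    simp [coeff_one, coeff_X, coeff_X_pow]

end Polygon

/-! ### Face numbers of products of polygons -/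

section PolygonProduct

/-- The coordinates of `ℝ^d` grouped into pairs, with possibly one left over. -/
def pairCoordinates (d : ℕ) :
    (Fin d → ℝ) ≃ₗ[ℝ] (Fin (d / 2) → Fin 2 → ℝ) × (Fin (d % 2) → ℝ) :=
  LinearEquiv.funCongrLeft ℝ ℝ
      (((finProdFinEquiv (m := d / 2) (n := 2)).sumCongr (Equiv.refl (Fin (d % 2)))).trans
        (finSumFinEquiv.trans (finCongr (by omega)))) ≪≫ₗ
    LinearEquiv.sumArrowLequivProdArrow (Fin (d / 2) × Fin 2) (Fin (d % 2)) ℝ ℝ ≪≫ₗ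
    (LinearEquiv.curry ℝ ℝ (Fin (d / 2)) (Fin 2)).prodCongr (LinearEquiv.refl ℝ _)

lemma pairCoordinates_fst {d : ℕ} (x : Fin d → ℝ) (i : Fin (d / 2)) :
    (pairCoordinates d x).1 i = ![x ⟨2 * i.val, by omega⟩, x ⟨2 * i.val + 1, by omega⟩] := by
  ext j
  fin_cases j
  · simp only [pairCoordinates]
    exact congrArg x (Fin.ext (by simp))
  · simp only [pairCoordinates]
    exact congrArg x (Fin.ext (by simp [add_comm]))

lemma pairCoordinates_snd {d : ℕ} (x : Fin d → ℝ) (i : Fin (d % 2)) :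
    (pairCoordinates d x).2 i = x ⟨d - 1, by have := i.2; omega⟩ := by
  simp only [pairCoordinates]
  exact congrArg x (Fin.ext (by simp; omega))

/-- The rows of a matrix as linear functionals. -/
noncomputable def rowSystem {q d : ℕ} (A : Matrix (Fin q) (Fin d) ℝ) :
    Fin q → (Fin d → ℝ) →ₗ[ℝ] ℝ :=
  fun j => LinearMap.proj j ∘ₗ A.mulVecLin

lemma faceNumber_polyhedron {q d : ℕ} (A : Matrix (Fin q) (Fin d) ℝ) (b : Fin q → ℝ) (k : ℕ) :
    faceNumber (polyhedron A b) k = (tightSets (rowSystem A) b k).ncard :=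
  faceNumber_eq_ncard_tightSets (rowSystem A) b k

lemma faceNumber_polygonProduct {d q : ℕ} {A : Fin (d / 2) → Matrix (Fin q) (Fin 2) ℝ}
    {b : Fin (d / 2) → Fin q → ℝ} (hq : 3 ≤ q) (h : ∀ i, IsPolygonSystem (A i) (b i)) (k : ℕ) :
    faceNumber (polygonProduct A b) k =
      ((C q * (1 + X) + X ^ 2) ^ (d / 2) * (1 + X) ^ (d % 2) : ℕ[X]).coeff k := by
  have hpoly : ∀ i, facePoly (rowSystem (A i)) (b i) = C q * (1 + X) + X ^ 2 := by
    intro i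
    have := facePoly_polygon (a := rowSystem (A i)) (β := b i) (by simp) (by simpa using hq)
      (by rw [← faceNumber_polyhedron, (h i).2, Fintype.card_fin])
    rwa [Fintype.card_fin] at this
  have hset : polygonProduct A b = {x | ∀ i,
      (prodSystem (piSystem fun i => rowSystem (A i))
        (piSystem fun (_ : Fin (d % 2)) (_ : Unit) => -(LinearMap.id : ℝ →ₗ[ℝ] ℝ)) i ∘ₗ
          (pairCoordinates d).toLinearMap) x ≤
      Sum.elim (fun p => b p.1 p.2) (fun _ => 0) i} := by
    ext x
    simp only [polygonProduct, Set.mem_ofPred_eq, Sum.forall, Prod.forall]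
    refine and_congr (forall_congr' fun i => ?_) ?_
    · rw [← pairCoordinates_fst]
      rfl
    · constructor
      · intro hx i _
        have h1 := hx (by have := i.2; omega)
        rw [← pairCoordinates_snd x i] at h1
        exact neg_nonpos.2 h1
      · intro hx hd
        have h1 := hx ⟨0, by omega⟩ ()
        rw [← pairCoordinates_snd x ⟨0, by omega⟩]
        exact neg_nonpos.1 h1
  rw [hset, faceNumber_eq_ncard_tightSets, ← coeff_facePoly, facePoly_comp_linearEquiv]
  have h1 := facePoly_piSystem (fun i => rowSystem (A i)) b
  have h2 := facePoly_piSystem (fun (_ : Fin (d % 2)) (_ : Unit) => -(LinearMap.id : ℝ →ₗ[ℝ] ℝ))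
    (fun _ _ => 0)
  rw [facePoly_prodSystem, h1, h2]
  simp only [hpoly, facePoly_halfLine, Finset.prod_const, Finset.card_univ, Fintype.card_fin]

/-- Here `c` counts the factors that contribute `X ^ 2`, the whole polygons; each of the other `m -
c` contributes `q * (1 + X)`, a vertex or an edge. -/
lemma coeff_polygonProduct (q m r k : ℕ) :
    ((C q * (1 + X) + X ^ 2) ^ m * (1 + X) ^ r : ℕ[X]).coeff k =
      ∑ c ∈ Finset.range (m + 1),
        if 2 * c ≤ k then m.choose c * q ^ (m - c) * (m - c + r).choose (k - 2 * c) else 0 := by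
  rw [add_comm (C q * (1 + X)), add_pow, Finset.sum_mul, finsetSum_coeff]
  refine Finset.sum_congr rfl fun c _ => ?_
  have : ((X ^ 2) ^ c * (C q * (1 + X)) ^ (m - c) * (m.choose c : ℕ[X]) * (1 + X) ^ r : ℕ[X]) =
      C (m.choose c * q ^ (m - c)) * ((1 + X) ^ (m - c + r) * X ^ (2 * c)) := by
    rw [mul_pow, ← C_pow, C_mul, pow_add, pow_mul, ← C_eq_natCast, Nat.cast_id]
    ring
  rw [this, coeff_C_mul, coeff_mul_X_pow', mul_ite, mul_zero, coeff_one_add_X_pow]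
  rfl

/-- Keeps only the term for `c` whole polygons; `b` and `s` are the numbers of vertices and edges,
and `δ` is the dimension of the chosen face of the half-line. -/
lemma le_coeff_polygonProduct {q m r k b s c δ : ℕ} (hr : r ≤ 1) (hδ : δ ≤ r)
    (hm : b + s + c = m) (hk : k = 2 * c + s + δ) :
    m.choose c * (b + s).choose s * q ^ (b + s) ≤
      ((C q * (1 + X) + X ^ 2) ^ m * (1 + X) ^ r : ℕ[X]).coeff k := by
  rw [coeff_polygonProduct]
  refine le_trans ?_ (Finset.single_le_sum (fun _ _ => Nat.zero_le _)
    (Finset.mem_range.2 (show c < m + 1 by omega)))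
  have h1 : m - c = b + s := by omega
  have h2 : k - 2 * c = s + δ := by omega
  have h3 : (b + s).choose s ≤ (b + s + r).choose (s + δ) := by
    interval_cases r <;> interval_cases δ
    · rfl
    · exact Nat.choose_le_succ _ _
    · rw [Nat.choose_succ_succ]
      omega
  rw [if_pos (by omega), h1, h2, mul_right_comm]
  gcongr

/-- A nonzero term needs `k - 2 * c ≤ m - c + r`, so its exponent `m - c` is at most `2 * m + r - k`
as well as at most `m`. Binomials are bounded by powers of two. -/
lemma coeff_polygonProduct_le {q m r k : ℕ} (hq : 1 ≤ q) :
    ((C q * (1 + X) + X ^ 2) ^ m * (1 + X) ^ r : ℕ[X]).coeff k ≤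
      (m + 1) * (2 ^ m * 2 ^ (m + r)) * q ^ min m (2 * m + r - k) := by
  rw [coeff_polygonProduct]
  refine (Finset.sum_le_card_nsmul _ _ (2 ^ m * 2 ^ (m + r) * q ^ min m (2 * m + r - k))
    fun c hc => ?_).trans (by simp [mul_assoc])
  rw [Finset.mem_range] at hc
  split_ifs with h
  · rcases lt_or_ge (m - c + r) (k - 2 * c) with h1 | h1
    · simp [Nat.choose_eq_zero_of_lt h1]
    · rw [mul_right_comm]
      refine Nat.mul_le_mul (Nat.mul_le_mul (Nat.choose_le_two_pow _ _) ?_) ?_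
      · exact (Nat.choose_le_two_pow _ _).trans (Nat.pow_le_pow_right (by norm_num) (by omega))
      · exact Nat.pow_le_pow_right hq (by omega)
  · exact Nat.zero_le _

end PolygonProduct

/-! ### Faces of dual cyclic polytopes as zero sets of polynomials -/

/-- `J` is the set of indices `i` at which some nonzero polynomial of degree at most `d`, that is
nonnegative at all the points `t i`, vanishes. -/
def IsZeroSet {n : ℕ} (d : ℕ) (t : Fin n → ℝ) (J : Finset (Fin n)) : Prop :=
  ∃ g : ℝ[X], g ≠ 0 ∧ g.natDegree ≤ d ∧ (∀ i, 0 ≤ g.eval (t i)) ∧ ∀ i, i ∈ J ↔ g.eval (t i) = 0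

/-- The non-constant coefficients of a polynomial. -/
noncomputable def tailCoeff (d : ℕ) (g : ℝ[X]) : Fin d → ℝ := fun i => g.coeff (i + 1)

/-- The affine extension to `ℝ^d` of the values of a polynomial on the moment curve. -/
noncomputable def affineValue {d : ℕ} (g : ℝ[X]) (c : Fin d → ℝ) : ℝ :=
  g.coeff 0 + tailCoeff d g ⬝ᵥ c

/-- The constraints of the polar dual of a cyclic polytope. -/
def dualSystem {n d : ℕ} (t : Fin n → ℝ) (c : Fin d → ℝ) : Fin n → (Fin d → ℝ) →ₗ[ℝ] ℝ :=
  fun i =>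
    { toFun := fun y => (momentCurve d (t i) - c) ⬝ᵥ y
      map_add' := dotProduct_add _
      map_smul' := fun r y => dotProduct_smul r _ y }

section DualCyclic

variable {n d : ℕ} {t : Fin n → ℝ} {c : Fin d → ℝ}

lemma dualSystem_apply (t : Fin n → ℝ) (c y : Fin d → ℝ) (i : Fin n) :
    dualSystem t c i y = (momentCurve d (t i) - c) ⬝ᵥ y := rfl

lemma affineValue_momentCurve {g : ℝ[X]} (hg : g.natDegree ≤ d) (s : ℝ) :
    affineValue g (momentCurve d s) = g.eval s := by
  rw [eval_eq_sum_range' (Nat.lt_succ_of_le hg), Finset.sum_range_succ', add_comm,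
    Finset.sum_range]
  simp [affineValue, tailCoeff, momentCurve, dotProduct]

lemma affineValue_sub_C_mul (g h : ℝ[X]) (r : ℝ) (c : Fin d → ℝ) :
    affineValue (h - C r * g) c = affineValue h c - r * affineValue g c := by
  simp only [affineValue, tailCoeff, dotProduct, coeff_sub, coeff_C_mul, sub_mul, mul_add,
    Finset.sum_sub_distrib, Finset.mul_sum, mul_assoc]
  ring

lemma dualSystem_tailCoeff {g : ℝ[X]} (hg : g.natDegree ≤ d) (t : Fin n → ℝ) (c : Fin d → ℝ)
    (i : Fin n) :
    dualSystem t c i (tailCoeff d g) = g.eval (t i) - affineValue g c := by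
  rw [← affineValue_momentCurve hg, dualSystem_apply, affineValue, affineValue,
    dotProduct_comm, dotProduct_sub]
  ring

lemma polarDual_cyclicPolytope (t : Fin n → ℝ) (c : Fin d → ℝ) :
    polarDual (cyclicPolytope d t) c = {y | ∀ i, dualSystem t c i y ≤ 1} := by
  ext y
  constructor
  · intro hy i
    exact hy _ (subset_convexHull ℝ _ ⟨i, rfl⟩)
  · intro hy x hx
    have hconv : Convex ℝ {x : Fin d → ℝ | (x - c) ⬝ᵥ y ≤ 1} := by
      intro x hx z hz p q hp hq hpq
      simp only [Set.mem_ofPred_eq, sub_dotProduct, add_dotProduct, smul_dotProduct,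
        smul_eq_mul] at *
      have h1 : c ⬝ᵥ y = p * (c ⬝ᵥ y) + q * (c ⬝ᵥ y) := by rw [← add_mul, hpq, one_mul]
      have h2 := mul_le_mul_of_nonneg_left hx hp
      have h3 := mul_le_mul_of_nonneg_left hz hq
      linarith
    exact convexHull_min (by rintro _ ⟨i, rfl⟩; exact hy i) hconv hx

/-- A nonzero polynomial that is nonnegative at the points `t i` is positive at interior points of
the cyclic polytope. -/
lemma affineValue_pos (hc : c ∈ interior (cyclicPolytope d t)) {g : ℝ[X]} (hg : g ≠ 0)
    (hd : g.natDegree ≤ d) (h0 : ∀ i, 0 ≤ g.eval (t i)) : 0 < affineValue g c := by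
  have hQ : ∀ x ∈ cyclicPolytope d t, 0 ≤ affineValue g x := by
    intro x hx
    have hconv : Convex ℝ {x : Fin d → ℝ | 0 ≤ affineValue g x} := by
      intro x hx z hz p q hp hq hpq
      simp only [Set.mem_ofPred_eq, affineValue, dotProduct_add, dotProduct_smul,
        smul_eq_mul] at *
      have : g.coeff 0 = p * g.coeff 0 + q * g.coeff 0 := by rw [← add_mul, hpq, one_mul]
      rw [this]
      have h1 := mul_nonneg hp hx
      have h2 := mul_nonneg hq hz
      linarith
    refine convexHull_min ?_ hconv hx
    rintro _ ⟨i, rfl⟩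
    show 0 ≤ affineValue g _
    rw [affineValue_momentCurve hd]
    exact h0 i
  -- Stepping from `c` against the gradient of `affineValue g` stays in the polytope and lowers the
  -- value by `ε` times the squared norm of the gradient, so the value at `c` is positive unless the
  -- gradient vanishes. In that case `g` is a nonzero constant.
  have hnear : ∀ᶠ ε : ℝ in nhdsWithin 0 (Set.Ioi 0),
      c - ε • tailCoeff d g ∈ cyclicPolytope d t := by
    have hcont : Filter.Tendsto (fun ε : ℝ => c - ε • tailCoeff d g) (nhdsWithin 0 (Set.Ioi 0))
        (nhds (c - (0 : ℝ) • tailCoeff d g)) :=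
      Filter.Tendsto.mono_left (Continuous.tendsto (by fun_prop) 0) nhdsWithin_le_nhds
    rw [zero_smul, sub_zero] at hcont
    exact hcont (mem_interior_iff_mem_nhds.1 hc)
  obtain ⟨ε, h1, h2⟩ := (hnear.and self_mem_nhdsWithin).exists
  have h2 : 0 < ε := h2
  have h3 := hQ _ h1
  have h4 : affineValue g (c - ε • tailCoeff d g) =
      affineValue g c - ε * (tailCoeff d g ⬝ᵥ tailCoeff d g) := by
    simp only [affineValue, dotProduct_sub, dotProduct_smul, smul_eq_mul]
    ring
  have h5 : 0 ≤ tailCoeff d g ⬝ᵥ tailCoeff d g :=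
    Finset.sum_nonneg fun i _ => mul_self_nonneg _
  rcases h5.eq_or_lt with h6 | h6
  · have h7 : tailCoeff d g = 0 := dotProduct_self_eq_zero.1 h6.symm
    have h8 := hQ c (interior_subset hc)
    refine lt_of_le_of_ne h8 fun h9 => hg ?_
    have h10 : g.coeff 0 = 0 := by
      rw [affineValue, h7, zero_dotProduct, add_zero] at h9
      exact h9.symm
    ext k
    rw [coeff_zero]
    rcases k with _ | k
    · exact h10
    · rcases lt_or_ge k d with hk | hk
      · exact congrFun h7 ⟨k, hk⟩
      · exact coeff_eq_zero_of_natDegree_lt (by omega)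
  · have := mul_pos h2 h6
    linarith

/-- A point `y` corresponds to the polynomial `1 - (momentCurve d s - c) ⬝ᵥ y` in `s`, which is
normalized to have `affineValue` 1 at `c`. Any admissible `g` can be so normalized because its
`affineValue` at `c` is positive. -/
lemma isTightSet_dualSystem (hc : c ∈ interior (cyclicPolytope d t)) {J : Finset (Fin n)} :
    IsTightSet (dualSystem t c) (fun _ => 1) (J : Set (Fin n)) ↔ IsZeroSet d t J := by
  constructor
  · rintro ⟨y, hy, hJ⟩
    set g : ℝ[X] := C (1 + c ⬝ᵥ y) - ∑ i : Fin d, C (y i) * X ^ (i.val + 1) with hg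
    have hev : ∀ i, g.eval (t i) = 1 - dualSystem t c i y := by
      intro i
      rw [dualSystem_apply, sub_dotProduct]
      simp only [hg, eval_sub, eval_C, eval_finsetSum, eval_mul, eval_pow, eval_X]
      have : momentCurve d (t i) ⬝ᵥ y = ∑ k : Fin d, y k * t i ^ (k.val + 1) := by
        simp only [dotProduct, momentCurve]
        exact Finset.sum_congr rfl fun k _ => mul_comm _ _
      rw [this]
      ring
    have hcoeff : ∀ k : Fin d, g.coeff (k + 1) = - y k := by
      intro k
      simp only [hg, coeff_sub, finsetSum_coeff, coeff_C_mul, coeff_X_pow, coeff_C_succ,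
        add_left_inj, Fin.val_inj]
      simp
    have hcoeff0 : g.coeff 0 = 1 + c ⬝ᵥ y := by
      simp [hg, finsetSum_coeff, coeff_X_pow]
    refine ⟨g, fun h => ?_, ?_, fun i => ?_, fun i => ?_⟩
    · have hy0 : y = 0 := by
        ext k
        have := hcoeff k
        rw [h, coeff_zero] at this
        simpa using this.symm
      rw [h, hy0] at hcoeff0
      simp at hcoeff0
    · refine (natDegree_sub_le _ _).trans (max_le (by simp) ?_)
      refine natDegree_sum_le_of_forall_le _ _ fun i _ => ?_
      exact (natDegree_C_mul_X_pow_le _ _).trans i.2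
    · rw [hev]
      linarith [hy i]
    · rw [hev, ← Finset.mem_coe, hJ]
      constructor <;> intro h <;> linarith
  · rintro ⟨g, hg, hd, h0, hJ⟩
    have hpos := affineValue_pos hc hg hd h0
    have hval : ∀ i, dualSystem t c i (-(affineValue g c)⁻¹ • tailCoeff d g) =
        1 - (affineValue g c)⁻¹ * g.eval (t i) := by
      intro i
      rw [map_smul, dualSystem_tailCoeff hd, smul_eq_mul]
      field_simp
      ring
    refine ⟨-(affineValue g c)⁻¹ • tailCoeff d g, fun i => ?_, fun i => ?_⟩
    · rw [hval]
      have := mul_nonneg (inv_pos.2 hpos).le (h0 i)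
      linarith
    · rw [hval, Finset.mem_coe, hJ]
      constructor
      · intro h
        rw [h]
        ring
      · intro h
        have h1 : (affineValue g c)⁻¹ * g.eval (t i) = 0 := by linarith
        exact (mul_eq_zero.1 h1).resolve_left (inv_pos.2 hpos).ne'

lemma IsZeroSet.card_le (ht : StrictMono t) {J : Finset (Fin n)} (hJ : IsZeroSet d t J) :
    J.card ≤ d := by
  obtain ⟨g, hg, hd, -, hJ⟩ := hJ
  by_contra! h
  refine hg (eq_zero_of_natDegree_lt_card_of_eval_eq_zero' g (J.image t) ?_ ?_)
  · intro x hx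
    obtain ⟨i, hi, rfl⟩ := Finset.mem_image.1 hx
    exact (hJ i).1 hi
  · rw [Finset.card_image_of_injective _ ht.injective]
    omega

/-- The constraints in `J` are linearly independent: arbitrary values on `J` are attained by
interpolation. -/
lemma finrank_tightKernel_dualSystem (ht : StrictMono t)
    (hc : c ∈ interior (cyclicPolytope d t)) {J : Finset (Fin n)} (hJ : IsZeroSet d t J) :
    Module.finrank ℝ (tightKernel (dualSystem t c) (J : Set (Fin n))) = d - J.card := by
  classical
  have hcard := hJ.card_le ht
  obtain ⟨g, hg, hd, h0, hgJ⟩ := hJ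
  have hpos := affineValue_pos hc hg hd h0
  set φ : (Fin d → ℝ) →ₗ[ℝ] (J → ℝ) := LinearMap.pi fun j => dualSystem t c j with hφ
  have hker : tightKernel (dualSystem t c) (J : Set (Fin n)) = LinearMap.ker φ := by
    ext v
    simp [mem_tightKernel, hφ, funext_iff]
  have hsurj : Function.Surjective φ := by
    intro w
    set r : Fin n → ℝ := fun i => if h : i ∈ J then w ⟨i, h⟩ else 0 with hr
    set h : ℝ[X] := Lagrange.interpolate J t r with hh
    have hinj : Set.InjOn t J := ht.injective.injOn
    have hev : ∀ i ∈ J, h.eval (t i) = r i := fun i hi =>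
      Lagrange.eval_interpolate_at_node r hinj hi
    have hdeg : h.natDegree ≤ d := by
      refine natDegree_le_of_degree_le ((Lagrange.degree_interpolate_lt r hinj).le.trans ?_)
      exact_mod_cast hcard
    -- Subtracting a multiple of `g`, which vanishes on `J`, makes the affine value at `c` zero
    -- without changing the values on `J`.
    set h' := h - C (affineValue h c / affineValue g c) * g with hh'
    have hdeg' : h'.natDegree ≤ d :=
      (natDegree_sub_le _ _).trans (max_le hdeg ((natDegree_C_mul_le _ _).trans hd))
    refine ⟨tailCoeff d h', ?_⟩
    ext ⟨j, hj⟩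
    show dualSystem t c j (tailCoeff d h') = w ⟨j, hj⟩
    rw [dualSystem_tailCoeff hdeg', hh', affineValue_sub_C_mul, div_mul_cancel₀ _ hpos.ne',
      sub_self, sub_zero, eval_sub, eval_mul, (hgJ j).1 hj, hev j hj]
    simp [hr, hj]
  have := LinearMap.finrank_range_add_finrank_ker φ
  rw [LinearMap.range_eq_top.2 hsurj, finrank_top] at this
  simp only [Module.finrank_fintype_fun_eq_card, Fintype.card_coe, Fintype.card_fin] at this
  rw [hker]
  omega

/-- The face numbers of a dual cyclic polytope count zero sets. -/
lemma faceNumber_polarDual_cyclicPolytope (ht : StrictMono t)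
    (hc : c ∈ interior (cyclicPolytope d t)) {k : ℕ} (hk : k ≤ d) :
    faceNumber (polarDual (cyclicPolytope d t) c) k =
      {J : Finset (Fin n) | IsZeroSet d t J ∧ J.card = d - k}.ncard := by
  classical
  rw [polarDual_cyclicPolytope, faceNumber_eq_ncard_tightSets]
  have : tightSets (dualSystem t c) (fun _ => 1) k =
      (fun J : Finset (Fin n) => (J : Set (Fin n))) ''
        {J : Finset (Fin n) | IsZeroSet d t J ∧ J.card = d - k} := by
    ext S
    constructor
    · rintro ⟨hS, hk'⟩
      have hS' : S = (S.toFinset : Set (Fin n)) := by simp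
      rw [hS'] at hS hk'
      rw [isTightSet_dualSystem hc] at hS
      rw [finrank_tightKernel_dualSystem ht hc hS] at hk'
      have := hS.card_le ht
      exact ⟨S.toFinset, ⟨hS, by omega⟩, hS'.symm⟩
    · rintro ⟨J, ⟨hJ, hk'⟩, rfl⟩
      refine ⟨(isTightSet_dualSystem hc).2 hJ, ?_⟩
      rw [finrank_tightKernel_dualSystem ht hc hJ]
      omega
  rw [this, Set.ncard_image_of_injective _ Finset.coe_injective]

end DualCyclic

/-! ### Combinatorics of zero sets and Gale's evenness condition -/

section ZeroSets

variable {n d : ℕ} {t : Fin n → ℝ}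

lemma eval_nodal_eq_zero_iff (ht : StrictMono t) (J : Finset (Fin n)) (i : Fin n) :
    (Lagrange.nodal J t).eval (t i) = 0 ↔ i ∈ J := by
  rw [Lagrange.eval_nodal, Finset.prod_eq_zero_iff]
  constructor
  · rintro ⟨j, hj, h⟩
    rwa [ht.injective (sub_eq_zero.1 h)]
  · exact fun h => ⟨i, h, sub_self _⟩

/-- Small sets of vertices of a cyclic polytope are faces. -/
lemma isZeroSet_of_card_le (ht : StrictMono t) {J : Finset (Fin n)} (hJ : 2 * J.card ≤ d) :
    IsZeroSet d t J := by
  refine ⟨Lagrange.nodal J t ^ 2, pow_ne_zero _ (Lagrange.nodal_monic).ne_zero, ?_, ?_, ?_⟩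
  · refine natDegree_pow_le.trans ?_
    rwa [Lagrange.natDegree_nodal]
  · intro i
    rw [eval_pow]
    positivity
  · intro i
    rw [eval_pow, pow_eq_zero_iff two_ne_zero, eval_nodal_eq_zero_iff ht]

/-- Faces of a cyclic polytope are closed under taking subsets. -/
lemma IsZeroSet.subset (ht : StrictMono t) (hn : d < n) {J F : Finset (Fin n)}
    (hF : IsZeroSet d t F) (h : J ⊆ F) : IsZeroSet d t J := by
  classical
  have hcard := hF.card_le ht
  obtain ⟨g, -, hd, h0, hgF⟩ := hF
  have hinj : Set.InjOn t F := ht.injective.injOn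
  -- The polynomial `q` is 0 on `J` and 1 on the rest of `F`. Adding a small positive multiple of it
  -- to `g` removes exactly the zeros outside `J`.
  set r : Fin n → ℝ := fun i => if i ∈ J then 0 else 1 with hr
  set q : ℝ[X] := Lagrange.interpolate F t r with hq
  have hev : ∀ i ∈ F, q.eval (t i) = r i := fun i hi =>
    Lagrange.eval_interpolate_at_node r hinj hi
  have hdeg : q.natDegree ≤ d := by
    refine natDegree_le_of_degree_le ((Lagrange.degree_interpolate_lt r hinj).le.trans ?_)
    exact_mod_cast hcard
  have hsmall : ∀ᶠ ε : ℝ in nhdsWithin 0 (Set.Ioi 0),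
      ∀ i, i ∉ F → 0 < g.eval (t i) + ε * q.eval (t i) := by
    rw [Filter.eventually_all]
    intro i
    by_cases hi : i ∈ F
    · simp [hi]
    have hpos : 0 < g.eval (t i) + 0 * q.eval (t i) := by
      rw [zero_mul, add_zero]
      exact (h0 i).lt_of_ne fun h => hi ((hgF i).2 h.symm)
    have hc : Filter.Tendsto (fun ε : ℝ => g.eval (t i) + ε * q.eval (t i))
        (nhdsWithin 0 (Set.Ioi 0)) (nhds (g.eval (t i) + 0 * q.eval (t i))) :=
      Filter.Tendsto.mono_left (Continuous.tendsto (by fun_prop) 0) nhdsWithin_le_nhds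
    filter_upwards [hc.eventually (lt_mem_nhds hpos)] with ε hε _ using hε
  obtain ⟨ε, h1, h2⟩ := (hsmall.and self_mem_nhdsWithin).exists
  have h2 : 0 < ε := h2
  have hval : ∀ i, (g + C ε * q).eval (t i) = g.eval (t i) + ε * q.eval (t i) := by simp
  have hvalF : ∀ i ∈ F, (g + C ε * q).eval (t i) = ε * r i := by
    intro i hi
    rw [hval, (hgF i).1 hi, hev i hi, zero_add]
  obtain ⟨i₀, hi₀⟩ : ∃ i, i ∉ F := by
    by_contra! hall
    rw [Finset.eq_univ_of_forall hall, Finset.card_univ, Fintype.card_fin] at hcard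
    omega
  refine ⟨g + C ε * q, fun h3 => ?_, ?_, fun i => ?_, fun i => ?_⟩
  · have := h1 i₀ hi₀
    rw [← hval, h3, eval_zero] at this
    exact lt_irrefl _ this
  · exact (natDegree_add_le _ _).trans (max_le hd ((natDegree_C_mul_le _ _).trans hdeg))
  · by_cases hi : i ∈ F
    · rw [hvalF i hi]
      simp only [hr]
      split_ifs <;> simp [h2.le]
    · rw [hval]
      exact (h1 i hi).le
  · by_cases hi : i ∈ F
    · rw [hvalF i hi]
      simp [hr, h2.ne']
    · rw [hval]
      exact iff_of_false (fun hiJ => hi (h hiJ)) (h1 i hi).ne'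

/-- A pivot step: take `h` vanishing on `J` and on one further index `i₁`, positive somewhere, and
subtract the largest multiple of `h` that keeps `g` nonnegative. This creates a new zero `i₂`, while
the value at `i₁` stays nonzero, so the result is not the zero polynomial. -/
lemma IsZeroSet.exists_ssubset (ht : StrictMono t) (hn : d < n) {J : Finset (Fin n)}
    (hJ : IsZeroSet d t J) (hcard : J.card < d) : ∃ F, J ⊂ F ∧ IsZeroSet d t F := by
  classical
  obtain ⟨g, -, hd, h0, hgJ⟩ := hJ
  have hex : ∀ K : Finset (Fin n), K.card ≤ d → ∃ i, i ∉ K := by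
    intro K hK
    by_contra! hall
    rw [Finset.eq_univ_of_forall hall, Finset.card_univ, Fintype.card_fin] at hK
    omega
  obtain ⟨i₁, hi₁⟩ := hex J hcard.le
  have hKcard : (insert i₁ J).card ≤ d := by
    rw [Finset.card_insert_of_notMem hi₁]
    exact hcard
  obtain ⟨i₀, hi₀⟩ := hex _ hKcard
  obtain ⟨h, hdeg, hzero, hpos⟩ : ∃ h : ℝ[X], h.natDegree ≤ d ∧
      (∀ i ∈ insert i₁ J, h.eval (t i) = 0) ∧ 0 < h.eval (t i₀) := by
    set p := Lagrange.nodal (insert i₁ J) t with hp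
    have h1 : p.natDegree ≤ d := by rwa [hp, Lagrange.natDegree_nodal]
    have h2 : ∀ i ∈ insert i₁ J, p.eval (t i) = 0 := fun i hi =>
      (eval_nodal_eq_zero_iff ht _ i).2 hi
    have h3 : p.eval (t i₀) ≠ 0 := fun h => hi₀ ((eval_nodal_eq_zero_iff ht _ i₀).1 h)
    rcases h3.lt_or_gt with h4 | h4
    · exact ⟨-p, by rwa [natDegree_neg], fun i hi => by simp [h2 i hi], by simpa using h4⟩
    · exact ⟨p, h1, h2, h4⟩
  obtain ⟨i₂, hi₂, hmin⟩ := Finset.exists_min_image {i | 0 < h.eval (t i)}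
    (fun i => g.eval (t i) / h.eval (t i)) ⟨i₀, by simpa using hpos⟩
  simp only [Finset.mem_filter, Finset.mem_univ, true_and] at hi₂ hmin
  set s := g.eval (t i₂) / h.eval (t i₂) with hs
  have hs0 : 0 ≤ s := div_nonneg (h0 _) hi₂.le
  have hval : ∀ i, (g - C s * h).eval (t i) = g.eval (t i) - s * h.eval (t i) := by simp
  refine ⟨({i | (g - C s * h).eval (t i) = 0} : Finset (Fin n)), ?_, g - C s * h, ?_, ?_, ?_, ?_⟩
  · rw [Finset.ssubset_iff_of_subset]
    · refine ⟨i₂, ?_, fun hi => ?_⟩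
      · rw [Finset.mem_filter, hval, hs, div_mul_cancel₀ _ hi₂.ne', sub_self]
        simp
      · exact hi₂.ne' (hzero i₂ (Finset.mem_insert_of_mem hi))
    · intro i hi
      rw [Finset.mem_filter, hval, (hgJ i).1 hi, hzero i (Finset.mem_insert_of_mem hi)]
      simp
  · intro h1
    have h2 := hval i₁
    rw [h1, eval_zero, hzero i₁ (Finset.mem_insert_self _ _), mul_zero, sub_zero] at h2
    exact hi₁ ((hgJ i₁).2 h2.symm)
  · exact (natDegree_sub_le _ _).trans (max_le hd ((natDegree_C_mul_le _ _).trans hdeg))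
  · intro i
    rw [hval]
    rcases lt_or_ge 0 (h.eval (t i)) with h1 | h1
    · have := (le_div_iff₀ h1).1 (hmin i h1)
      linarith
    · have := mul_nonpos_of_nonneg_of_nonpos hs0 h1
      linarith [h0 i]
  · intro i
    simp

/-- Every face of a cyclic polytope lies in a facet. -/
lemma IsZeroSet.exists_facet (ht : StrictMono t) (hn : d < n) {J : Finset (Fin n)}
    (hJ : IsZeroSet d t J) : ∃ F, J ⊆ F ∧ IsZeroSet d t F ∧ F.card = d := by
  obtain ⟨F, hJF, hF⟩ := (Set.toFinite {F | IsZeroSet d t F}).exists_le_maximal hJ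
  refine ⟨F, hJF, hF.prop, (hF.prop.card_le ht).antisymm ?_⟩
  by_contra! h
  obtain ⟨K, hFK, hK⟩ := hF.prop.exists_ssubset ht hn h
  exact hFK.2 (hF.2 hK hFK.1)

/-- The number of elements of `F` above `i`. -/
def numAbove {n : ℕ} (F : Finset (Fin n)) (i : Fin n) : ℕ := {f ∈ F | i < f}.card

lemma eval_nodal_sign (ht : StrictMono t) {F : Finset (Fin n)} {i : Fin n} (hi : i ∉ F) :
    0 < (-1) ^ numAbove F i * (Lagrange.nodal F t).eval (t i) := by
  classical
  have h1 : (-1 : ℝ) ^ numAbove F i = ∏ f ∈ F, if i < f then (-1 : ℝ) else 1 := by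
    rw [Finset.prod_ite]
    simp [numAbove]
  rw [h1, Lagrange.eval_nodal, ← Finset.prod_mul_distrib]
  refine Finset.prod_pos fun f hf => ?_
  split_ifs with h
  · have := ht h
    linarith
  · have : f < i := lt_of_le_of_ne (not_lt.1 h) fun h => hi (h ▸ hf)
    have := ht this
    linarith

/-- Gale's evenness condition. -/
lemma IsZeroSet.even_numAbove (ht : StrictMono t) {F : Finset (Fin n)} (hF : IsZeroSet d t F)
    (hcard : F.card = d) {i j : Fin n} (hi : i ∉ F) (hj : j ∉ F) :
    numAbove F i % 2 = numAbove F j % 2 := by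
  classical
  obtain ⟨g, -, hd, h0, hgF⟩ := hF
  have hpos : ∀ {i}, i ∉ F → 0 < g.eval (t i) := fun {i} hi =>
    (h0 i).lt_of_ne fun h => hi ((hgF i).2 h.symm)
  have hne : (Lagrange.nodal F t).eval (t i) ≠ 0 := fun h =>
    hi ((eval_nodal_eq_zero_iff ht F i).1 h)
  set u := g.eval (t i) / (Lagrange.nodal F t).eval (t i) with hu
  -- A polynomial of degree at most `d` vanishing at the `d` nodes of `F` is a multiple of the nodal
  -- polynomial. The latter then has the same sign at `i` and `j`, and this sign is the parity of
  -- `numAbove`.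
  have hg : g - C u * Lagrange.nodal F t = 0 := by
    refine eq_zero_of_natDegree_lt_card_of_eval_eq_zero' _ ((insert i F).image t) ?_ ?_
    · intro x hx
      obtain ⟨k, hk, rfl⟩ := Finset.mem_image.1 hx
      rw [eval_sub, eval_mul, eval_C]
      rcases Finset.mem_insert.1 hk with rfl | hk
      · rw [hu, div_mul_cancel₀ _ hne, sub_self]
      · rw [(hgF k).1 hk, (eval_nodal_eq_zero_iff ht F k).2 hk, mul_zero, sub_zero]
    · rw [Finset.card_image_of_injective _ ht.injective, Finset.card_insert_of_notMem hi]
      refine Nat.lt_succ_of_le ((natDegree_sub_le _ _).trans (max_le (by omega) ?_))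
      exact (natDegree_C_mul_le _ _).trans (by rw [Lagrange.natDegree_nodal])
  have hval : ∀ k, g.eval (t k) = u * (Lagrange.nodal F t).eval (t k) := by
    intro k
    have := congrArg (eval (t k)) hg
    simpa [sub_eq_zero] using this
  have h1 := eval_nodal_sign ht hi
  have h2 := eval_nodal_sign ht hj
  have h3 := mul_pos (hpos hi) (hpos hj)
  rw [hval i, hval j] at h3
  have h4 := mul_pos h1 h2
  have h5 : 0 < (-1 : ℝ) ^ (numAbove F i + numAbove F j) *
      ((Lagrange.nodal F t).eval (t i) * (Lagrange.nodal F t).eval (t j)) := by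
    rw [pow_add]
    linarith
  have h6 : 0 < (Lagrange.nodal F t).eval (t i) * (Lagrange.nodal F t).eval (t j) := by
    by_contra! h
    nlinarith [mul_self_nonneg u]
  have h7 : Even (numAbove F i + numAbove F j) := by
    by_contra hodd
    rw [Nat.not_even_iff_odd] at hodd
    rw [hodd.neg_one_pow] at h5
    linarith
  rw [Nat.even_iff] at h7
  omega

end ZeroSets

/-! ### Splitting facets into pairs and counting faces -/

section Gale

variable {N : ℕ}

lemma numAbove_last (F : Finset (Fin (N + 1))) : numAbove F (Fin.last N) = 0 := by
  simp [numAbove, Finset.filter_eq_empty_iff, Fin.le_last]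

lemma numAbove_zero (F : Finset (Fin (N + 1))) :
    numAbove F 0 + (if 0 ∈ F then 1 else 0) = F.card := by
  have h : {f ∈ F | 0 < f} = F.erase 0 := by
    ext f
    simp [Fin.pos_iff_ne_zero, and_comm]
  rw [numAbove, h, Finset.card_erase_eq_ite]
  split_ifs with h0
  · have := Finset.card_pos.2 ⟨_, h0⟩
    omega
  · rfl

lemma numAbove_eq_finRotate (F : Finset (Fin (N + 1))) {i : Fin (N + 1)} (hi : i ≠ Fin.last N) :
    numAbove F i = numAbove F (finRotate (N + 1) i) +
      (if finRotate (N + 1) i ∈ F then 1 else 0) := by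
  classical
  have hv : (finRotate (N + 1) i).val = i.val + 1 := coe_finRotate_of_ne_last hi
  have h : {f ∈ F | i < f} = {f ∈ F | finRotate (N + 1) i < f} ∪
      {f ∈ F | f = finRotate (N + 1) i} := by
    ext f
    simp only [Finset.mem_filter, Finset.mem_union, Fin.lt_def, Fin.ext_iff, hv]
    constructor
    · rintro ⟨h1, h2⟩
      rcases eq_or_ne f.val (i.val + 1) with h3 | h3
      · exact Or.inr ⟨h1, h3⟩
      · exact Or.inl ⟨h1, by omega⟩
    · rintro (⟨h1, h2⟩ | ⟨h1, h2⟩)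
      · exact ⟨h1, by omega⟩
      · exact ⟨h1, by omega⟩
  rw [numAbove, h, Finset.card_union_of_disjoint, numAbove, Finset.filter_eq']
  · split_ifs <;> simp
  · rw [Finset.disjoint_filter]
    rintro f - h1 rfl
    exact lt_irrefl _ h1

lemma exists_finRotate_eq {i : Fin (N + 1)} (hi : i ≠ 0) :
    ∃ j, j ≠ Fin.last N ∧ finRotate (N + 1) j = i := by
  refine ⟨(finRotate (N + 1)).symm i, fun h => hi ?_, by simp⟩
  rw [← finRotate_last, ← h, Equiv.apply_symm_apply]

/-- A set satisfying Gale's evenness condition consists of disjoint cyclically consecutive pairs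
and, if its cardinality is odd, an end point. -/
lemma exists_pairs_of_even_numAbove {F : Finset (Fin (N + 1))}
    (hF : ∀ i j, i ∉ F → j ∉ F → numAbove F i % 2 = numAbove F j % 2) (hne : ∃ i, i ∉ F) :
    ∃ L E : Finset (Fin (N + 1)), F = L ∪ L.image (finRotate (N + 1)) ∪ E ∧
      Disjoint L (L.image (finRotate (N + 1))) ∧
      Disjoint (L ∪ L.image (finRotate (N + 1))) E ∧ E.card = F.card % 2 ∧
      (E = ∅ ∨ E = {0} ∨ E = {Fin.last N}) := by
  classical
  obtain ⟨i₀, hi₀⟩ := hne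
  obtain ⟨p, hp⟩ : ∃ p, ∀ i, i ∉ F → numAbove F i % 2 = p := ⟨_, fun i hi => hF i i₀ hi hi₀⟩
  have hp2 : p = 0 ∨ p = 1 := by
    have := hp i₀ hi₀
    omega
  have hz := numAbove_zero F
  have hl := numAbove_last F
  -- it suffices to describe the parity classes of `F`
  suffices ∃ L E : Finset (Fin (N + 1)), (∀ f ∈ L, numAbove F f % 2 = 1 - p) ∧
      (∀ f ∈ L, finRotate (N + 1) f ∈ F ∧ numAbove F (finRotate (N + 1) f) % 2 = p) ∧
      (∀ f ∈ F, f ∉ E → f ∈ L ∨ ∃ g ∈ L, finRotate (N + 1) g = f) ∧ L ⊆ F ∧ E ⊆ F ∧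
      (∀ f ∈ L, f ∉ E ∧ finRotate (N + 1) f ∉ E) ∧
      E.card = F.card % 2 ∧ (E = ∅ ∨ E = {0} ∨ E = {Fin.last N}) by
    obtain ⟨L, E, h1, h2, h3, h4, h5, h6, h7, h8⟩ := this
    refine ⟨L, E, ?_, ?_, ?_, h7, h8⟩
    · ext f
      simp only [Finset.mem_union, Finset.mem_image]
      constructor
      · intro hf
        by_cases hE : f ∈ E
        · exact Or.inr hE
        · exact Or.inl (h3 f hf hE)
      · rintro ((hf | ⟨g, hg, rfl⟩) | hf)
        exacts [h4 hf, (h2 g hg).1, h5 hf]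
    · rw [Finset.disjoint_left]
      intro f hf hf'
      obtain ⟨g, hg, rfl⟩ := Finset.mem_image.1 hf'
      have := h1 _ hf
      have := (h2 g hg).2
      omega
    · rw [Finset.disjoint_left]
      intro f hf
      rcases Finset.mem_union.1 hf with hf | hf
      · exact (h6 f hf).1
      · obtain ⟨g, hg, rfl⟩ := Finset.mem_image.1 hf
        exact (h6 g hg).2
  rcases hp2 with rfl | rfl
  -- Parity 0 off `F`: an element with an odd count has its successor in `F`, and these two form a
  -- pair. An element with an even count is such a successor, except 0, which is left over exactly
  -- when the cardinality of `F` is odd.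
  · have hlast : ∀ f, numAbove F f % 2 = 1 → f ≠ Fin.last N := by
      rintro f hf rfl
      omega
    refine ⟨{f ∈ F | numAbove F f % 2 = 1}, if F.card % 2 = 1 then {0} else ∅, ?_, ?_, ?_,
      Finset.filter_subset _ _, ?_, ?_, ?_, ?_⟩
    · intro f hf
      exact (Finset.mem_filter.1 hf).2
    · intro f hf
      have hodd := (Finset.mem_filter.1 hf).2
      have hrot := numAbove_eq_finRotate F (hlast f hodd)
      have hmem : finRotate (N + 1) f ∈ F := by
        by_contra h
        have := hp _ h
        rw [if_neg h] at hrot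
        omega
      rw [if_pos hmem] at hrot
      exact ⟨hmem, by omega⟩
    · intro f hf hE
      by_cases hodd : numAbove F f % 2 = 1
      · exact Or.inl (Finset.mem_filter.2 ⟨hf, hodd⟩)
      · right
        have hf0 : f ≠ 0 := by
          rintro rfl
          rw [if_pos hf] at hz
          rw [if_pos (by omega)] at hE
          simp at hE
        obtain ⟨g, hg, rfl⟩ := exists_finRotate_eq hf0
        have hrot := numAbove_eq_finRotate F hg
        rw [if_pos hf] at hrot
        have hgF : g ∈ F := by
          by_contra h
          have := hp _ h
          omega
        exact ⟨g, Finset.mem_filter.2 ⟨hgF, by omega⟩, rfl⟩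
    · split_ifs with h
      · rw [Finset.singleton_subset_iff]
        by_contra h0
        have := hp _ h0
        rw [if_neg h0] at hz
        omega
      · exact Finset.empty_subset _
    · intro f hf
      have hodd := (Finset.mem_filter.1 hf).2
      split_ifs with h
      · simp only [Finset.mem_singleton]
        constructor
        · rintro rfl
          rw [if_pos (Finset.mem_filter.1 hf).1] at hz
          omega
        · intro h0
          have hv : (finRotate (N + 1) f).val = f.val + 1 :=
            coe_finRotate_of_ne_last (hlast f hodd)
          rw [h0] at hv
          simp at hv
      · simp
    · split_ifs with h
      · simp [h]
      · simp
        omega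
    · split_ifs <;> simp
  -- Parity 1 off `F`: the last index has count 0, so it lies in `F`. Pairs now start at even
  -- counts; the last index is paired cyclically with 0 if the cardinality of `F` is even, and is
  -- left over otherwise.
  · have hlastF : Fin.last N ∈ F := by
      by_contra h
      have := hp _ h
      omega
    refine ⟨{f ∈ F | numAbove F f % 2 = 0 ∧ (F.card % 2 = 1 → f ≠ Fin.last N)},
      if F.card % 2 = 1 then {Fin.last N} else ∅, ?_, ?_, ?_,
      Finset.filter_subset _ _, ?_, ?_, ?_, ?_⟩
    · intro f hf
      exact (Finset.mem_filter.1 hf).2.1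
    · intro f hf
      obtain ⟨hfF, heven, hlast⟩ := Finset.mem_filter.1 hf
      rcases eq_or_ne f (Fin.last N) with rfl | hfl
      · have hcard : ¬ F.card % 2 = 1 := fun h => hlast h rfl
        rw [finRotate_last]
        have h0F : (0 : Fin (N + 1)) ∈ F := by
          by_contra h0
          have := hp _ h0
          rw [if_neg h0] at hz
          omega
        rw [if_pos h0F] at hz
        exact ⟨h0F, by omega⟩
      · have hrot := numAbove_eq_finRotate F hfl
        have hmem : finRotate (N + 1) f ∈ F := by
          by_contra h
          have := hp _ h
          rw [if_neg h] at hrot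
          omega
        rw [if_pos hmem] at hrot
        exact ⟨hmem, by omega⟩
    · intro f hf hE
      by_cases heven : numAbove F f % 2 = 0
      · refine Or.inl (Finset.mem_filter.2 ⟨hf, heven, fun h => ?_⟩)
        rw [if_pos h] at hE
        simpa using hE
      · right
        rcases eq_or_ne f 0 with rfl | hf0
        · rw [if_pos hf] at hz
          exact ⟨Fin.last N, Finset.mem_filter.2 ⟨hlastF, by omega, fun h => by omega⟩,
            finRotate_last⟩
        · obtain ⟨g, hg, rfl⟩ := exists_finRotate_eq hf0
          have hrot := numAbove_eq_finRotate F hg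
          rw [if_pos hf] at hrot
          have hgF : g ∈ F := by
            by_contra h
            have := hp _ h
            omega
          exact ⟨g, Finset.mem_filter.2 ⟨hgF, by omega, fun _ => hg⟩, rfl⟩
    · split_ifs with h
      · simpa using hlastF
      · exact Finset.empty_subset _
    · intro f hf
      obtain ⟨hfF, heven, hlast⟩ := Finset.mem_filter.1 hf
      split_ifs with h
      · simp only [Finset.mem_singleton]
        refine ⟨hlast h, fun h0 => ?_⟩
        have hrot := numAbove_eq_finRotate F (hlast h)
        rw [h0, if_pos hlastF] at hrot
        omega
      · simp
    · split_ifs with h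
      · simp [h]
      · simp
        omega
    · split_ifs <;> simp

/-- A subset of a union of disjoint pairs and a remainder splits into full pairs, single elements
and a part of the remainder. -/
lemma exists_pairs_singles {α : Type*} [DecidableEq α] (σ : Equiv.Perm α) {J L E : Finset α}
    (hJ : J ⊆ L ∪ L.image σ ∪ E) (h1 : Disjoint L (L.image σ))
    (h2 : Disjoint (L ∪ L.image σ) E) :
    ∃ B S : Finset α, J = B ∪ B.image σ ∪ S ∪ J ∩ E ∧
      2 * B.card + S.card + (J ∩ E).card = J.card ∧ B.card + S.card ≤ L.card := by
  -- `J₁` and `J₂` index the pairs whose first, respectively second, element is in `J`. The full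
  -- pairs are `J₁ ∩ J₂`, and the singles come from the symmetric difference, so together they are
  -- as many as `J₁ ∪ J₂`.
  set J₁ := L ∩ J with hJ₁
  set J₂ := {l ∈ L | σ l ∈ J} with hJ₂
  have hJeq : J = J₁ ∪ J₂.image σ ∪ J ∩ E := by
    ext x
    simp only [hJ₁, hJ₂, Finset.mem_union, Finset.mem_inter, Finset.mem_image, Finset.mem_filter]
    constructor
    · intro hx
      have := hJ hx
      simp only [Finset.mem_union, Finset.mem_image] at this
      rcases this with (h | ⟨l, hl, rfl⟩) | h
      · exact Or.inl (Or.inl ⟨h, hx⟩)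
      · exact Or.inl (Or.inr ⟨l, ⟨hl, hx⟩, rfl⟩)
      · exact Or.inr ⟨hx, h⟩
    · rintro ((⟨-, h⟩ | ⟨l, ⟨-, h⟩, rfl⟩) | ⟨h, -⟩) <;> exact h
  have hsub₁ : J₁ ⊆ L := Finset.inter_subset_left
  have hsub₂ : J₂ ⊆ L := Finset.filter_subset _ _
  have hd1 : Disjoint J₁ (J₂.image σ) :=
    h1.mono hsub₁ (Finset.image_subset_image hsub₂)
  have hd2 : Disjoint (J₁ ∪ J₂.image σ) (J ∩ E) :=
    h2.mono (Finset.union_subset_union hsub₁ (Finset.image_subset_image hsub₂))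
      Finset.inter_subset_right
  have hcard : J.card = J₁.card + J₂.card + (J ∩ E).card := by
    conv_lhs => rw [hJeq]
    rw [Finset.card_union_of_disjoint hd2, Finset.card_union_of_disjoint hd1,
      Finset.card_image_of_injective _ σ.injective]
  have hS : ((J₁ \ J₂) ∪ (J₂ \ J₁).image σ).card = (J₁ \ J₂).card + (J₂ \ J₁).card := by
    rw [Finset.card_union_of_disjoint, Finset.card_image_of_injective _ σ.injective]
    exact hd1.mono Finset.sdiff_subset (Finset.image_subset_image Finset.sdiff_subset)
  have e1 := Finset.card_inter_add_card_sdiff J₁ J₂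
  have e2 := Finset.card_inter_add_card_sdiff J₂ J₁
  have e3 := Finset.card_union_add_card_inter J₁ J₂
  have e4 := Finset.card_le_card (Finset.union_subset hsub₁ hsub₂)
  rw [Finset.inter_comm] at e2
  refine ⟨J₁ ∩ J₂, (J₁ \ J₂) ∪ (J₂ \ J₁).image σ, ?_, ?_, ?_⟩
  · conv_lhs => rw [hJeq]
    congr 1
    ext x
    simp only [Finset.mem_union, Finset.mem_inter, Finset.mem_image, Finset.mem_sdiff]
    constructor
    · rintro (hx | ⟨l, hl, rfl⟩)
      · by_cases h : x ∈ J₂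
        · exact Or.inl (Or.inl ⟨hx, h⟩)
        · exact Or.inr (Or.inl ⟨hx, h⟩)
      · by_cases h : l ∈ J₁
        · exact Or.inl (Or.inr ⟨l, ⟨h, hl⟩, rfl⟩)
        · exact Or.inr (Or.inr ⟨l, ⟨hl, h⟩, rfl⟩)
    · rintro ((h | ⟨l, h, rfl⟩) | (h | ⟨l, h, rfl⟩))
      exacts [Or.inl h.1, Or.inr ⟨l, h.2, rfl⟩, Or.inl h.1, Or.inr ⟨l, h.1, rfl⟩]
  · omega
  · omega

/-- Counting faces of a cyclic polytope by their numbers of pairs and singles. -/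
lemma ncard_zeroSets_le {n d j M : ℕ} {t : Fin n → ℝ} (ht : StrictMono t) (hn : d < n)
    (hM : ∀ b s ε, ε ≤ d % 2 → 2 * b + s + ε = j → b + s ≤ d / 2 →
      n.choose b * n.choose s ≤ M) :
    {J : Finset (Fin n) | IsZeroSet d t J ∧ J.card = j}.ncard ≤ 3 * (d + 1) ^ 2 * M := by
  classical
  obtain ⟨N, rfl⟩ : ∃ N, n = N + 1 := ⟨n - 1, by omega⟩
  -- The types: numbers of pairs and singles, and the part of the end index contained in `J`. The
  -- factor `3 * (d + 1) ^ 2` bounds their number.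
  set I : Finset ((ℕ × ℕ) × Finset (Fin (N + 1))) :=
    {x ∈ (Finset.range (d + 1) ×ˢ Finset.range (d + 1)) ×ˢ {∅, {0}, {Fin.last N}} |
      x.2.card ≤ d % 2 ∧ 2 * x.1.1 + x.1.2 + x.2.card = j ∧ x.1.1 + x.1.2 ≤ d / 2} with hI
  set f : (ℕ × ℕ) × Finset (Fin (N + 1)) → Finset (Finset (Fin (N + 1))) := fun x =>
    (Finset.powersetCard x.1.1 Finset.univ ×ˢ Finset.powersetCard x.1.2 Finset.univ).image
      fun y => y.1 ∪ y.1.image (finRotate (N + 1)) ∪ y.2 ∪ x.2 with hf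
  have hsub : {J : Finset (Fin (N + 1)) | IsZeroSet d t J ∧ J.card = j} ⊆
      (I.biUnion f : Set (Finset (Fin (N + 1)))) := by
    rintro J ⟨hJ, hj⟩
    obtain ⟨F, hJF, hF, hFc⟩ := hJ.exists_facet ht hn
    have hne : ∃ i, i ∉ F := by
      by_contra! hall
      rw [Finset.eq_univ_of_forall hall, Finset.card_univ, Fintype.card_fin] at hFc
      omega
    obtain ⟨L, E, hFeq, h1, h2, hE, hE'⟩ :=
      exists_pairs_of_even_numAbove (fun i j hi hj => hF.even_numAbove ht hFc hi hj) hne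
    obtain ⟨B, S, hJeq, hcard, hle⟩ := exists_pairs_singles _ (hFeq ▸ hJF) h1 h2
    have hL : L.card = d / 2 := by
      have : F.card = L.card + L.card + E.card := by
        conv_lhs => rw [hFeq]
        rw [Finset.card_union_of_disjoint h2, Finset.card_union_of_disjoint h1,
          Finset.card_image_of_injective _ (finRotate (N + 1)).injective]
      omega
    have hEc : (J ∩ E).card ≤ d % 2 := by
      rw [← hFc, ← hE]
      exact Finset.card_le_card Finset.inter_subset_right
    have hJE : J ∩ E = ∅ ∨ J ∩ E = {0} ∨ J ∩ E = {Fin.last N} := by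
      rcases hE' with h | h | h
      · exact Or.inl (by simp [h])
      · rw [h]
        rcases Finset.subset_singleton_iff.1 (Finset.inter_subset_right (s₁ := J)
          (s₂ := {(0 : Fin (N + 1))})) with h' | h' <;> simp [h']
      · rw [h]
        rcases Finset.subset_singleton_iff.1 (Finset.inter_subset_right (s₁ := J)
          (s₂ := {Fin.last N})) with h' | h' <;> simp [h']
    rw [Finset.mem_coe, Finset.mem_biUnion]
    refine ⟨((B.card, S.card), J ∩ E), ?_, ?_⟩
    · simp only [hI, Finset.mem_filter, Finset.mem_product, Finset.mem_range, Finset.mem_insert,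
        Finset.mem_singleton]
      exact ⟨⟨⟨by omega, by omega⟩, hJE⟩, hEc, by omega, by omega⟩
    · simp only [hf, Finset.mem_image, Finset.mem_product, Finset.mem_powersetCard]
      exact ⟨(B, S), ⟨⟨Finset.subset_univ _, rfl⟩, Finset.subset_univ _, rfl⟩, hJeq.symm⟩
  have hIcard : I.card ≤ 3 * (d + 1) ^ 2 := by
    refine (Finset.card_filter_le _ _).trans ?_
    rw [Finset.card_product, Finset.card_product, Finset.card_range, mul_comm, ← sq]
    exact Nat.mul_le_mul_right _ Finset.card_le_three
  calc {J : Finset (Fin (N + 1)) | IsZeroSet d t J ∧ J.card = j}.ncard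
      ≤ (I.biUnion f : Set (Finset (Fin (N + 1)))).ncard :=
        Set.ncard_le_ncard hsub (Finset.finite_toSet _)
    _ = (I.biUnion f).card := Set.ncard_coe_finset _
    _ ≤ I.card * M := by
        refine Finset.card_biUnion_le_card_mul _ _ _ fun x hx => ?_
        simp only [hI, Finset.mem_filter] at hx
        refine Finset.card_image_le.trans ?_
        rw [Finset.card_product, Finset.card_powersetCard, Finset.card_powersetCard,
          Finset.card_univ, Fintype.card_fin]
        exact hM _ _ _ hx.2.1 hx.2.2.1 hx.2.2.2
    _ ≤ 3 * (d + 1) ^ 2 * M := Nat.mul_le_mul_right _ hIcard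

/-- A lower bound for the number of faces of a cyclic polytope. -/
lemma choose_le_ncard_zeroSets {n d j : ℕ} {t : Fin n → ℝ} (ht : StrictMono t) (hn : d < n)
    (hj : j ≤ d) :
    n.choose (min (d / 2) j) ≤
      {J : Finset (Fin n) | IsZeroSet d t J ∧ J.card = j}.ncard * 2 ^ d := by
  classical
  set i := min (d / 2) j with hi
  set Z : Finset (Finset (Fin n)) := {J | IsZeroSet d t J ∧ J.card = j} with hZ
  have hZc : {J : Finset (Fin n) | IsZeroSet d t J ∧ J.card = j}.ncard = Z.card := by
    rw [← Set.ncard_coe_finset]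
    congr 1
    ext J
    simp [hZ]
  -- Each `i`-set is a zero set because `2 * i ≤ d`. Enlarging it inside a facet gives a zero set of
  -- size `j`, which contains at most `2 ^ d` such sets.
  have hsub : Finset.powersetCard i (Finset.univ : Finset (Fin n)) ⊆
      Z.biUnion Finset.powerset := by
    intro K hK
    obtain ⟨-, hK⟩ := Finset.mem_powersetCard.1 hK
    have hKz : IsZeroSet d t K := isZeroSet_of_card_le ht (by omega)
    obtain ⟨F, hKF, hF, hFc⟩ := hKz.exists_facet ht hn
    obtain ⟨J, hKJ, hJF, hJ⟩ := Finset.exists_subsuperset_card_eq hKF (n := j) (by omega)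
      (by omega)
    rw [Finset.mem_biUnion]
    refine ⟨J, ?_, Finset.mem_powerset.2 hKJ⟩
    simp only [hZ, Finset.mem_filter, Finset.mem_univ, true_and]
    exact ⟨hF.subset ht hn hJF, hJ⟩
  have h1 := Finset.card_le_card hsub
  rw [Finset.card_powersetCard, Finset.card_univ, Fintype.card_fin] at h1
  rw [hZc]
  refine h1.trans (Finset.card_biUnion_le_card_mul _ _ _ fun J hJ => ?_)
  simp only [hZ, Finset.mem_filter, Finset.mem_univ, true_and] at hJ
  rw [Finset.card_powerset, hJ.2]
  exact Nat.pow_le_pow_right (by norm_num) hj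

end Gale

/-! ### Comparison of binomial coefficients -/

section Estimates

/-- The quotient of `m ^ N` by `m.descFactorial N` does not increase with `m`, by Bernoulli's
inequality, and at `m = N` it is `N ^ N / N!`, a term of the series of `exp N`. -/
lemma pow_le_exp_mul_descFactorial {m N : ℕ} (h : N ≤ m) :
    (m : ℝ) ^ N ≤ Real.exp N * m.descFactorial N := by
  induction m, h using Nat.le_induction with
  | base =>
    rw [Nat.descFactorial_self]
    have := Real.pow_div_factorial_le_exp (x := (N : ℝ)) (Nat.cast_nonneg _) N
    rwa [div_le_iff₀ (by positivity)] at this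
  | succ m hm ih =>
    have hpos : (0 : ℝ) < (m : ℝ) + 1 - N := by
      have : (N : ℝ) ≤ m := by exact_mod_cast hm
      linarith
    have h1 : ((m : ℝ) + 1 - N) * (m + 1).descFactorial N = (m + 1) * m.descFactorial N := by
      have := Nat.succ_descFactorial m N
      have h2 : ((m + 1 - N : ℕ) : ℝ) = (m : ℝ) + 1 - N := by
        rw [Nat.cast_sub (by omega)]
        push_cast
        ring
      rw [← h2]
      exact_mod_cast this
    have h2 : ((m : ℝ) + 1 - N) * (m + 1) ^ N ≤ (m + 1) * (m : ℝ) ^ N := by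
      have hb := one_add_mul_le_pow (a := -(1 / ((m : ℝ) + 1)))
        (by
          have : 1 / ((m : ℝ) + 1) ≤ 1 := by
            rw [div_le_one (by positivity)]
            linarith [Nat.cast_nonneg (α := ℝ) m]
          linarith) N
      have e1 : 1 + (N : ℝ) * -(1 / ((m : ℝ) + 1)) = ((m : ℝ) + 1 - N) / (m + 1) := by
        field_simp
        ring
      have e2 : 1 + -(1 / ((m : ℝ) + 1)) = (m : ℝ) / (m + 1) := by
        field_simp
        ring
      rw [e1, e2, div_pow, div_le_div_iff₀ (by positivity) (by positivity)] at hb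
      linarith
    refine le_of_mul_le_mul_left ?_ hpos
    calc ((m : ℝ) + 1 - N) * ((m + 1 : ℕ) : ℝ) ^ N ≤ (m + 1) * (m : ℝ) ^ N := by
          exact_mod_cast h2
      _ ≤ (m + 1) * (Real.exp N * m.descFactorial N) := by gcongr
      _ = ((m : ℝ) + 1 - N) * (Real.exp N * (m + 1).descFactorial N) := by
          rw [mul_left_comm, ← h1]
          ring

/-- Bounds the faces of one type of c* by those of the matching type of P*. Both sides are compared
with `(m * q) ^ (b + s) / (b! * s!)`. -/
lemma choose_mul_choose_le {m q n r b s c : ℕ} (hm : 1 ≤ m) (hq : 1 ≤ q) (hr : r ≤ 1)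
    (hn : n = m * q + r) (hbsc : b + s + c = m) :
    (n.choose b * n.choose s : ℝ) ≤
      Real.exp 1 * Real.exp ((b + s : ℕ) : ℝ) *
        (m.choose c * (b + s).choose s * q ^ (b + s) : ℕ) := by
  have h1 : (n.choose b * n.choose s : ℝ) ≤ (n : ℝ) ^ (b + s) / (b.factorial * s.factorial) := by
    rw [pow_add, ← div_mul_div_comm]
    exact mul_le_mul (Nat.choose_le_pow_div b n) (Nat.choose_le_pow_div s n) (by positivity)
      (by positivity)
  have hmq : (1 : ℝ) ≤ m * q := by exact_mod_cast Nat.mul_le_mul hm hq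
  -- The additional inequality for odd `d` costs at most `(1 + 1 / (m * q)) ^ (b + s) ≤ e`, as `b +
  -- s ≤ m * q`.
  have h2 : (n : ℝ) ^ (b + s) ≤ Real.exp 1 * ((m : ℝ) * q) ^ (b + s) := by
    have h3 : (n : ℝ) ≤ (m * q) * Real.exp (1 / (m * q)) := by
      have h4 := Real.add_one_le_exp (1 / ((m : ℝ) * q))
      have h5 : (r : ℝ) ≤ 1 := by exact_mod_cast hr
      calc (n : ℝ) ≤ m * q + 1 := by rw [hn]; push_cast; linarith
        _ = (m * q) * (1 / (m * q) + 1) := by field_simp; ring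
        _ ≤ _ := by gcongr
    calc (n : ℝ) ^ (b + s) ≤ ((m * q) * Real.exp (1 / (m * q))) ^ (b + s) := by gcongr
      _ = Real.exp ((b + s : ℕ) * (1 / (m * q))) * (m * q) ^ (b + s) := by
          rw [mul_pow, ← Real.exp_nat_mul, mul_comm]
      _ ≤ Real.exp 1 * (m * q) ^ (b + s) := by
          gcongr
          rw [mul_one_div, div_le_one (by positivity)]
          have : b + s ≤ m * q := by nlinarith
          exact_mod_cast this
  have h3 := pow_le_exp_mul_descFactorial (show b + s ≤ m by omega)
  have h4 : (m.descFactorial (b + s) : ℝ) =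
      (b.factorial * s.factorial) * (m.choose c * (b + s).choose s) := by
    have e1 : m.choose c = m.choose (b + s) := by
      rw [← Nat.choose_symm_of_eq_add (show m = c + (b + s) by omega)]
    have e2 := Nat.add_choose_mul_factorial_mul_factorial b s
    rw [e1, Nat.descFactorial_eq_factorial_mul_choose, ← e2]
    push_cast
    ring
  refine h1.trans ?_
  rw [div_le_iff₀ (by positivity)]
  calc (n : ℝ) ^ (b + s) ≤ Real.exp 1 * ((m : ℝ) ^ (b + s) * q ^ (b + s)) := by
        rwa [← mul_pow]
    _ ≤ Real.exp 1 * ((Real.exp ((b + s : ℕ) : ℝ) * m.descFactorial (b + s)) * q ^ (b + s)) := by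
        gcongr
    _ = _ := by
        rw [h4]
        push_cast
        ring

end Estimates

/-! ### Comparison of the face numbers -/

section Comparison

variable {n d : ℕ} {P D : Set (Fin d → ℝ)}

lemma IsPStar.exists_faceNumber (hn : d < n) (hP : IsPStar n d P) :
    ∃ q, 3 ≤ q ∧ n = d / 2 * q + d % 2 ∧ ∀ k, faceNumber P k =
      ((C q * (1 + X) + X ^ 2) ^ (d / 2) * (1 + X) ^ (d % 2) : ℕ[X]).coeff k := by
  obtain ⟨q, A, b, hq, hAb, rfl⟩ := hP
  -- With `q ≤ 2` the number of constraints would be at most `d`.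
  have h3 : 3 ≤ q := by
    by_contra! h
    have : d / 2 * q ≤ d / 2 * 2 := Nat.mul_le_mul_left _ (by omega)
    omega
  exact ⟨q, h3, hq, faceNumber_polygonProduct h3 hAb⟩

lemma IsDualCyclic.exists_faceNumber (hD : IsDualCyclic n d D) :
    ∃ t : Fin n → ℝ, StrictMono t ∧ ∀ k ≤ d, faceNumber D k =
      {J : Finset (Fin n) | IsZeroSet d t J ∧ J.card = d - k}.ncard := by
  obtain ⟨t, c, ht, hc, rfl⟩ := hD
  exact ⟨t, ht, fun k hk => faceNumber_polarDual_cyclicPolytope ht hc hk⟩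

lemma faceNumber_dualCyclic_le (hd : 2 ≤ d) (hn : d < n) (hP : IsPStar n d P)
    (hD : IsDualCyclic n d D) {k : ℕ} (hk : k ≤ d) :
    (faceNumber D k : ℝ) ≤ 3 * Real.exp 1 * ((d : ℝ) + 1) ^ 2 *
      Real.exp ((min (d / 2) (d - k) : ℕ) : ℝ) * faceNumber P k := by
  obtain ⟨q, hq, hnq, hPk⟩ := hP.exists_faceNumber hn
  obtain ⟨t, ht, hDk⟩ := hD.exists_faceNumber
  set R : ℝ := Real.exp 1 * Real.exp ((min (d / 2) (d - k) : ℕ) : ℝ) * faceNumber P k with hR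
  have hR0 : 0 ≤ R := by positivity
  -- The bound per type has to be a natural number, so `R` is rounded down. The matching faces of P*
  -- have `c = d / 2 - (b + s)` whole polygons and `δ = d % 2 - ε`: a tight end index corresponds to
  -- the end point of the half-line.
  have h1 := ncard_zeroSets_le (j := d - k) (M := ⌊R⌋₊) ht hn fun b s ε hε hj hbs => by
    refine Nat.le_floor ?_
    push_cast
    refine (choose_mul_choose_le (c := d / 2 - (b + s)) (by omega) (by omega) (by omega) hnq
      (by omega)).trans ?_
    rw [hR, hPk]
    gcongr
    · omega
    · exact le_coeff_polygonProduct (δ := d % 2 - ε) (by omega) (by omega) (by omega) (by omega)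
  rw [hDk k hk]
  calc (({J : Finset (Fin n) | IsZeroSet d t J ∧ J.card = d - k}.ncard : ℕ) : ℝ)
      ≤ ((3 * (d + 1) ^ 2 * ⌊R⌋₊ : ℕ) : ℝ) := by exact_mod_cast h1
    _ = 3 * ((d : ℝ) + 1) ^ 2 * (⌊R⌋₊ : ℝ) := by push_cast; ring
    _ ≤ 3 * ((d : ℝ) + 1) ^ 2 * R := by
        gcongr
        exact Nat.floor_le hR0
    _ = _ := by rw [hR]; ring

lemma faceNumber_polygonProduct_le (hd : 2 ≤ d) (hn : d < n) (hP : IsPStar n d P)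
    (hD : IsDualCyclic n d D) {k : ℕ} (hk : k ≤ d) :
    faceNumber P k ≤ (d / 2 + 1) * (2 ^ (d / 2) * 2 ^ (d / 2 + d % 2)) * d.factorial * 2 ^ d *
      faceNumber D k := by
  obtain ⟨q, hq, hnq, hPk⟩ := hP.exists_faceNumber hn
  obtain ⟨t, ht, hDk⟩ := hD.exists_faceNumber
  have h1 := choose_le_ncard_zeroSets ht hn (show d - k ≤ d by omega)
  rw [← hDk k hk] at h1
  have h2 := coeff_polygonProduct_le (q := q) (m := d / 2) (r := d % 2) (k := k) (by omega)
  rw [← hPk, show 2 * (d / 2) + d % 2 - k = d - k by omega] at h2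
  set i := min (d / 2) (d - k) with hi
  have h3 : q ^ i ≤ d.factorial * n.choose i := by
    -- With `d / 2 = u + 1`, `n` is at least `u * q + q ≥ u + q`, while `i ≤ u + 1`.
    have hle : q ≤ n + 1 - i := by
      obtain ⟨u, hu⟩ : ∃ u, d / 2 = u + 1 := ⟨d / 2 - 1, by omega⟩
      have h4 : d / 2 * q = u * q + q := by rw [hu]; ring
      have h5 : u ≤ u * q := Nat.le_mul_of_pos_right _ (by omega)
      omega
    calc q ^ i ≤ (n + 1 - i) ^ i := Nat.pow_le_pow_left hle _
      _ ≤ n.descFactorial i := Nat.pow_sub_le_descFactorial _ _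
      _ = i.factorial * n.choose i := Nat.descFactorial_eq_factorial_mul_choose _ _
      _ ≤ d.factorial * n.choose i := Nat.mul_le_mul_right _ (Nat.factorial_le (by omega))
  calc faceNumber P k ≤ (d / 2 + 1) * (2 ^ (d / 2) * 2 ^ (d / 2 + d % 2)) * q ^ i := h2
    _ ≤ (d / 2 + 1) * (2 ^ (d / 2) * 2 ^ (d / 2 + d % 2)) *
          (d.factorial * (faceNumber D k * 2 ^ d)) :=
        Nat.mul_le_mul_left _ (h3.trans (Nat.mul_le_mul_left _ h1))
    _ = _ := by ring

end Comparison

theorem mainTheorem2 :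
    (∃ p : Polynomial ℝ, ∀ n d k : ℕ, 2 ≤ d → d < n → k ≤ d →
      ∀ P C : Set (Fin d → ℝ), IsPStar n d P → IsDualCyclic n d C →
        (k < (d + 1) / 2 →
          (faceNumber C k : ℝ) ≤
            p.eval (d : ℝ) * Real.exp ((d / 2 : ℕ) : ℝ) * (faceNumber P k : ℝ)) ∧
        ((d + 1) / 2 ≤ k →
          (faceNumber C k : ℝ) ≤
            p.eval (d : ℝ) * Real.exp ((d : ℝ) - (k : ℝ)) * (faceNumber P k : ℝ))) ∧
    (∀ d : ℕ, 2 ≤ d → ∃ a b : ℝ, 0 < a ∧ 0 < b ∧ ∀ n k : ℕ, d < n → k ≤ d →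
      ∀ P C : Set (Fin d → ℝ), IsPStar n d P → IsDualCyclic n d C →
        a * (faceNumber P k : ℝ) ≤ (faceNumber C k : ℝ) ∧
        (faceNumber C k : ℝ) ≤ b * (faceNumber P k : ℝ)) := by

  constructor
  -- The exponent `min (d / 2) (d - k)` covers both ranges of `k`; the threshold only decides which
  -- term is smaller.
  · refine ⟨Polynomial.C (3 * Real.exp 1) * (Polynomial.X + 1) ^ 2, ?_⟩
    intro n d k hd hn hk P D hP hD
    have h := faceNumber_dualCyclic_le hd hn hP hD hk
    simp only [Polynomial.eval_mul, Polynomial.eval_C, Polynomial.eval_pow, Polynomial.eval_add,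
      Polynomial.eval_X, Polynomial.eval_one]
    constructor
    · intro _
      refine h.trans ?_
      gcongr
      exact min_le_left _ _
    · intro _
      refine h.trans ?_
      gcongr
      rw [← Nat.cast_sub hk]
      exact_mod_cast min_le_right _ _
  · intro d hd
    set K : ℕ := (d / 2 + 1) * (2 ^ (d / 2) * 2 ^ (d / 2 + d % 2)) * d.factorial * 2 ^ d with hK
    have hKpos : (0 : ℝ) < K := by
      have : 0 < K := by positivity
      exact_mod_cast this
    refine ⟨(K : ℝ)⁻¹,
      3 * Real.exp 1 * ((d : ℝ) + 1) ^ 2 * Real.exp ((d / 2 : ℕ) : ℝ), inv_pos.2 hKpos,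
      by positivity, ?_⟩
    intro n k hn hk P D hP hD
    constructor
    · rw [inv_mul_le_iff₀ hKpos]
      exact_mod_cast faceNumber_polygonProduct_le hd hn hP hD hk
    · refine (faceNumber_dualCyclic_le hd hn hP hD hk).trans ?_
      gcongr
      exact min_le_left _ _
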